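/- **Setting.** Let $G=(V,E)$ be a finite non-empty $(D+1)$-regular graph, with coupling strengths $\{J_e\}_{e\in E}$ and field strengths $\{h_v\}_{v\in V}$. The couplings are i.i.d. copies of a real random variable $J$ with finite fourth moment, the fields are i.i.d. with finite second moment, and all of them are independent. Let $$H_P=\sum_{\{u,v\}\in E}J_{uv}Z_uZ_v+\sum_{v\in V}h_vZ_v,\qquad H_M=\sum_{v\in V}X_v,\qquad |\gamma,\beta\rangle=e^{-i\beta H_M}e^{-i\gamma H_P}|s\rangle ,$$ where $|s\rangle$ is the uniform superposition, and let $\xi_G(\gamma,\beta)=\langle\gamma,\beta|H_P|\gamma,\beta\rangle$ be the QAOA$_1$ cost. Fix $0\le\lambda,\mu\le1$. Assume that for every edge $\{u,v\}$ the number of common neighbours of $u,v$ is $|F_{uv}|=bD^\mu$, and that each endpoint of the edge has exactly $|\overline F_{uv}|=aD^\lambda$ neighbours, other than the opposite endpoint, that are not adjacent to the opposite endpoint; here $a,b\ge0$ (so $aD^\lambda+bD^\mu=D$). The coefficients $a,b$ may vary with $D$ but stay bounded. Put $$\mathcal C_1(\alpha,\beta)=2\alpha\sin(4\beta)\,\mathbb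 E[J^2]\,e^{-2\alpha^2\mathbb E[J^2]}\tfrac1{\sqrt D},\qquad \mathcal C_2(\alpha,\beta,\theta_1,\theta_2)=\sin^2(2\beta)\,\mathbb E[J]\,e^{-4\theta_1\alpha^2\mathbb E[J^2]}\sinh\!\big(4\theta_2\alpha^2\mathbb E[J]^2\big),$$ $$\mathcal C_3(\alpha,\beta)=4b\alpha^2\sin^2(2\beta)\,\mathbb E[J]^3e^{-4a\alpha^2\mathbb E[J^2]}D^{\mu-1}.$$ **Expansions.** Let $\alpha>0$ be fixed and $\gamma=\alpha/\sqrt D$. Then $\xi_G(\gamma,\beta)$ is integrable and, as $D\to\infty$, $\frac1{|E|}\mathbb E[\xi_G(\gamma,\beta)]$ equals 1. $\mathcal C_1+O(D^{-1})$ if $b=0$, $a=\lambda=1$; 2. $\mathcal C_1+\mathcal C_2(\alpha,\beta,1,1)+O(D^{-1})$ if $a=0$, $b=\mu=1$; 3. $\mathcal C_1+\mathcal C_2(\alpha,\beta,1,b)+O(D^{-1})$ if $a,b>0$, $\lambda=\mu=1$; 4. $\mathcal C_1+\mathcal C_2(\alpha,\beta,b,b)+O(D^{\lambda-1})$ if $a,b>0$,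 $\mu=1$, $\lambda<\frac12$; 5. $\mathcal C_1+\mathcal C_2(\alpha,\beta,b,b)\big(1-4a\alpha^2\mathbb E[J^2]\tfrac1{\sqrt D}\big)+O(D^{\max(2\lambda-2,-1)})$ if $a,b>0$, $\mu=1$, $\lambda=\frac12$; 6. $\mathcal C_2(\alpha,\beta,b,b)\big(1-4a\alpha^2\mathbb E[J^2]D^{\lambda-1}\big)+O(D^{\max(-1/2,\,2\lambda-2)})$ if $a,b>0$, $\mu=1$, $\frac12<\lambda<1$; 7. $\mathcal C_3+O(D^{\max(-1/2,\,2\mu-2)})$ if $a,b>0$, $\lambda=1$, $\frac12<\mu<1$; 8. $\mathcal C_1+4b\alpha^2\sin^2(2\beta)\mathbb E[J]^3e^{-4a\alpha^2\mathbb E[J^2]}\tfrac1{\sqrt D}+O(D^{-1})$ if $a,b>0$, $\lambda=1$, $\mu=\frac12$; 9. $\mathcal C_1+O(D^{\mu-1})$ if $a,b>0$, $\lambda=1$, $\mu<\frac12$. The implied constants depend only on $\alpha,\lambda,\mu$, the laws of the couplings and of the fields, and a bound for $a,b$; they do not depend on $\beta$ or on the graph. **Optimal angle.** Let $$\eta(\theta)=\frac1{\sqrt{\theta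 D\,\mathbb E[J^2]}},\qquad \zeta(\theta_1,\theta_2)=\sqrt{\frac1{8\theta_2D\,\mathbb E[J]^2}\ln\frac{\theta_1\mathbb E[J^2]+\theta_2\mathbb E[J]^2}{\theta_1\mathbb E[J^2]-\theta_2\mathbb E[J]^2}} .$$ For $D\ge1$ regard the leading term $L$ of the expansion as a function of $\gamma=\alpha/\sqrt D$ and $\beta$. In the following regimes $L$ and the optimal angle $\gamma^*\in\mathbb R^+$ are - $b=0$, $a=\lambda=1$: $L=\mathcal C_1$, $\gamma^*=\eta(4)$; - $a=0$, $b=\mu=1$: $L=\mathcal C_2(\cdot,\cdot,1,1)$, $\gamma^*=\zeta(1,1)$; - $a,b>0$, $\lambda=\mu=1$ (so $a+b=1$): $L=\mathcal C_2(\cdot,\cdot,1,b)$, $\gamma^*=\zeta(1,b)$; - $a,b>0$, $\mu=1$, $\lambda<1$: $L=\mathcal C_2(\cdot,\cdot,b,b)$, $\gamma^*=\zeta(b,b)$; - $a,b>0$, $\lambda=1$, $\frac12<\mu<1$: $L=\mathcal C_3$, $\gamma^*=\eta(4a)$; - $a,b>0$, $\lambda=1$, $\mu<\frac12$: $L=\mathcal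 C_1$, $\gamma^*=\eta(4)$. Here $\mathbb E[J^2]>0$ is assumed for $L=\mathcal C_1$, and $\mathrm{Var}(J)>0$ for $\zeta(1,1)$ and $\zeta(b,b)$. For $L=\mathcal C_1$, and for $L=\mathcal C_2,\mathcal C_3$ when $\mathbb E[J]<0$, this means: $\gamma^*$ is the unique $\gamma>0$ that belongs to a global minimiser $(\gamma,\beta)$ of $L$ on $\mathbb R^+\times\mathbb R$; and it is the first local optimum on $\mathbb R^+$, i.e. $\gamma\mapsto\inf_\beta L(\gamma,\beta)$ has a local minimum at $\gamma^*$ and no local extremum in $(0,\gamma^*)$. For $L=\mathcal C_2,\mathcal C_3$ when $\mathbb E[J]>0$, minimisation is trivial (the minimum of $L$ over all angles is attained at $\gamma=0$), and $\gamma^*$ has the same two properties for $-L$, i.e. for maximisation. -/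

import Mathlib

open MeasureTheory

noncomputable section

namespace QAOA

/-! ### Level-1 QAOA for an Ising model on a graph -/

section Circuit

variable {V : Type*} [Fintype V] [DecidableEq V]

/-- Operators on the `|V|`-qubit space, written in the computational basis `V → Bool`. -/
abbrev Op (V : Type*) : Type _ := Matrix (V → Bool) (V → Bool) ℂ

/-- Pauli `Z` on qubit `j`: the basis vector `z` has eigenvalue `(-1) ^ (z j)`. -/
def pauliZ (j : V) : Op V := Matrix.diagonal fun z => if z j then (-1 : ℂ) else 1

/-- Pauli `X` on qubit `j`: it flips the bit `z j`. -/
def pauliX (j : V) : Op V :=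
  Matrix.of fun y z => if y = Function.update z j (!(z j)) then (1 : ℂ) else 0

/-- The interaction `Z_u Z_v` of an unordered pair `{u, v}`. -/
def pauliZZ (e : Sym2 V) : Op V :=
  Sym2.lift ⟨fun u v => pauliZ u * pauliZ v, fun u v => by
    simp only [pauliZ, Matrix.diagonal_mul_diagonal, mul_comm]⟩ e

/-- The problem Hamiltonian `H_P = ∑_{{u,v} ∈ E} J_{uv} Z_u Z_v + ∑_v h_v Z_v`;
each edge is counted once. -/
def problemHam (G : SimpleGraph V) [DecidableRel G.Adj] (J : G.edgeSet → ℝ) (h : V → ℝ) : Op V :=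
  ∑ e : G.edgeSet, (J e : ℂ) • pauliZZ (e : Sym2 V) + ∑ v : V, (h v : ℂ) • pauliZ v

/-- The mixing Hamiltonian `H_M = ∑_v X_v`. -/
def mixingHam (V : Type*) [Fintype V] [DecidableEq V] : Op V := ∑ v : V, pauliX v

/-- The uniform superposition `|s⟩`. -/
def uniformState (V : Type*) [Fintype V] : (V → Bool) → ℂ :=
  fun _ => ((1 / Real.sqrt (2 ^ Fintype.card V) : ℝ) : ℂ)

/-- The state `|γ, β⟩ = exp(-i β H_M) exp(-i γ H_P) |s⟩`. -/
def qaoaState (G : SimpleGraph V) [DecidableRel G.Adj] (J : G.edgeSet → ℝ) (h : V → ℝ)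
    (γ β : ℝ) : (V → Bool) → ℂ :=
  Matrix.mulVec (NormedSpace.exp ((-(Complex.I * (β : ℂ))) • mixingHam V))
    (Matrix.mulVec (NormedSpace.exp ((-(Complex.I * (γ : ℂ))) • problemHam G J h))
      (uniformState V))

/-- The cost `ξ_G(γ, β) = ⟨γ, β| H_P |γ, β⟩` (a real number, since `H_P` is Hermitian). -/
def qaoaCost (G : SimpleGraph V) [DecidableRel G.Adj] (J : G.edgeSet → ℝ) (h : V → ℝ)
    (γ β : ℝ) : ℝ :=
  (dotProduct (star (qaoaState G J h γ β))
    (Matrix.mulVec (problemHam G J h) (qaoaState G J h γ β))).re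

/-- The joint law of the couplings and the fields: all independent, couplings with law `f`,
fields with law `g`. -/
def weightLaw (G : SimpleGraph V) [DecidableRel G.Adj] (f g : Measure ℝ) :
    Measure ((G.edgeSet → ℝ) × (V → ℝ)) :=
  (Measure.pi fun _ : G.edgeSet => f).prod (Measure.pi fun _ : V => g)

/-- The scaled expected cost `(1 / |E|) 𝔼[ξ_G(γ, β)]`. -/
def scaledExpectedCost (G : SimpleGraph V) [DecidableRel G.Adj] (f g : Measure ℝ)
    (γ β : ℝ) : ℝ :=
  (1 / (G.edgeFinset.card : ℝ)) * ∫ w, qaoaCost G w.1 w.2 γ β ∂(weightLaw G f g)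

/-- `F_{uv}`: the common neighbours of `u` and `v`. -/
def triangleNbrs (G : SimpleGraph V) [DecidableRel G.Adj] (u v : V) : Finset V :=
  G.neighborFinset u ∩ G.neighborFinset v

/-- The neighbours of `u`, other than `v`, that are not neighbours of `v`. -/
def nonTriangleNbrs (G : SimpleGraph V) [DecidableRel G.Adj] (u v : V) : Finset V :=
  (G.neighborFinset u \ G.neighborFinset v).erase v

/-- `G` is `(D+1)`-regular, every edge `{u, v}` lies in `b D ^ μ` triangles, and each endpoint of it
has `a D ^ lam` further neighbours that are not adjacent to the other endpoint. -/
def HasCounts (G : SimpleGraph V) [DecidableRel G.Adj] (D : ℕ) (a b lam μ : ℝ) : Prop :=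
  G.IsRegularOfDegree (D + 1) ∧
    ∀ u v : V, G.Adj u v →
      ((nonTriangleNbrs G u v).card : ℝ) = a * (D : ℝ) ^ lam ∧
      ((triangleNbrs G u v).card : ℝ) = b * (D : ℝ) ^ μ

end Circuit

/-! ### Leading terms -/

/-- `𝔼[J]` -/
def m1 (f : Measure ℝ) : ℝ := ∫ x, x ∂f

/-- `𝔼[J²]` -/
def m2 (f : Measure ℝ) : ℝ := ∫ x, x ^ 2 ∂f

def C1 (f : Measure ℝ) (D : ℕ) (α β : ℝ) : ℝ :=
  2 * α * Real.sin (4 * β) * m2 f * Real.exp (-2 * α ^ 2 * m2 f) * (1 / Real.sqrt D)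

def C2 (f : Measure ℝ) (α β θ₁ θ₂ : ℝ) : ℝ :=
  Real.sin (2 * β) ^ 2 * m1 f * Real.exp (-4 * θ₁ * α ^ 2 * m2 f) *
    Real.sinh (4 * θ₂ * α ^ 2 * m1 f ^ 2)

def C3 (f : Measure ℝ) (D : ℕ) (a b μ α β : ℝ) : ℝ :=
  4 * b * α ^ 2 * Real.sin (2 * β) ^ 2 * m1 f ^ 3 * Real.exp (-4 * a * α ^ 2 * m2 f) *
    (D : ℝ) ^ (μ - 1)

/-- For fixed `α`, the scaled expected cost at `γ = α / √D` equals `main D a b β + O(D ^ r)` as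
`D → ∞`, over all graphs with counts `a D ^ lam`, `b D ^ μ` where `(a, b)` satisfies `P`.
The implied constant depends on `f, g, α, lam, μ` and on an upper bound `A` for the bounded
coefficients `a, b` (which may vary with `D`), but not on the graph or on `β`. -/
def Expansion (f g : Measure ℝ) (α lam μ : ℝ) (P : ℝ → ℝ → Prop)
    (main : ℕ → ℝ → ℝ → ℝ → ℝ) (r : ℝ) : Prop :=
  ∀ A : ℝ, ∃ (K : ℝ) (D₀ : ℕ), ∀ D : ℕ, D₀ ≤ D → ∀ a b : ℝ,
    0 ≤ a → a ≤ A → 0 ≤ b → b ≤ A → P a b →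
    ∀ (V : Type*) [Fintype V] [DecidableEq V] [Nonempty V] (G : SimpleGraph V)
      [DecidableRel G.Adj], HasCounts G D a b lam μ →
      ∀ β : ℝ,
        Integrable (fun w : (G.edgeSet → ℝ) × (V → ℝ) =>
          qaoaCost G w.1 w.2 (α / Real.sqrt D) β) (weightLaw G f g) ∧
        |scaledExpectedCost G f g (α / Real.sqrt D) β - main D a b β| ≤ K * (D : ℝ) ^ r

/-! ### Optimal angles -/

def eta (f : Measure ℝ) (D : ℕ) (θ : ℝ) : ℝ := 1 / Real.sqrt (θ * D * m2 f)

def zeta (f : Measure ℝ) (D : ℕ) (θ₁ θ₂ : ℝ) : ℝ :=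
  Real.sqrt (1 / (8 * θ₂ * D * m1 f ^ 2) *
    Real.log ((θ₁ * m2 f + θ₂ * m1 f ^ 2) / (θ₁ * m2 f - θ₂ * m1 f ^ 2)))

/-- `γ` is the first coordinate of a minimiser of `L` on `ℝ⁺ × ℝ`. -/
def IsGlobalOptimum (L : ℝ → ℝ → ℝ) (γ : ℝ) : Prop :=
  0 < γ ∧ ∃ β : ℝ, ∀ γ' : ℝ, 0 < γ' → ∀ β' : ℝ, L γ β ≤ L γ' β'

/-- `γ` is a local minimum of `p` on `ℝ⁺`, and no smaller positive number is a local extremum. -/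
def IsFirstLocalOptimum (p : ℝ → ℝ) (γ : ℝ) : Prop :=
  0 < γ ∧ IsLocalMin p γ ∧ ∀ γ' : ℝ, 0 < γ' → γ' < γ → ¬ IsLocalExtr p γ'

/-- `γ` is the unique globally optimal angle of `L` on `ℝ⁺`, and it is the first local optimum of
the univariate function obtained by optimising over `β` for each angle. -/
def IsOptimalAngle (L : ℝ → ℝ → ℝ) (γ : ℝ) : Prop :=
  (∀ γ' : ℝ, IsGlobalOptimum L γ' ↔ γ' = γ) ∧ IsFirstLocalOptimum (fun γ' => ⨅ β : ℝ, L γ' β) γ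

/-- Optimality for a leading term whose sign is that of the mean `m`: if `m < 0` then `γ` is the
optimal angle for minimisation; if `0 < m` then minimisation is trivial (the minimum over all
angles is attained at angle `0`) and `γ` is the optimal angle for maximisation. -/
def IsSignedOptimalAngle (m : ℝ) (L : ℝ → ℝ → ℝ) (γ : ℝ) : Prop :=
  (m < 0 → IsOptimalAngle L γ) ∧
  (0 < m → IsOptimalAngle (fun γ' β => -L γ' β) γ ∧ ∀ γ' β β' : ℝ, L 0 β ≤ L γ' β')

end QAOA

end

set_option linter.unusedSectionVars false

noncomputable section

namespace QAOA

/-! ### Expectation values of Pauli operators in the QAOA state -/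

/-! The proof computes the mean of each edge term exactly for every finite degree, expands it once
uniformly in the number of triangles, and reads all nine regimes off that single expansion.

Exact formula. Conjugation by the mixer turns `Z_u` into `cos(2β) Z_u + i sin(2β) X_u Z_u`
(`pauliZ_mul_mixer`). The state `exp(-iγ H_P)|s⟩` has amplitudes of constant modulus, so an
expectation value becomes an average over spin configurations `z` of phases `exp(iγ(C(z) - C(z')))`,
where `z'` is `z` with one or two spins flipped (`expVal_pauliZZ`). Only weights at flipped vertices
enter such a phase. By independence its mean over the weights is a product of characteristic
functions, one per weight, and the spin average then factorises over the vertices outside the edge.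
A vertex adjacent to one flipped endpoint contributes `𝔼 cos(2γJ)`. When both endpoints are flipped,
a common neighbour contributes the real part of the squared characteristic function or its squared
modulus, according to whether the endpoint spins agree. The result is `edgeMean`. The field terms of
the cost are bounded by a constant per vertex, and there are `2/(D+1)` vertices per edge, so they
cost `O(1/D)` (`scaledExpectedCost_sub_edgeMean_le`).

Uniform expansion. At `γ = α/√D` each of these factors agrees with a Gaussian exponential up to
`O(D⁻²)`. All bases lie in the unit interval, so powers with `O(D)` factors cost only `O(1/D)`.
Hence with `m` common neighbours the edge mean is `C1 + C2(α, β, 1, m/D) + O(1/D)`, whatever `m` is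
(`abs_edgeMean_sub_le`); the `sinh` is half the difference of the two spin alignments. The regimes
now follow from calculus in `t = m/D = b D^(μ-1)` and `s = a D^(lam-1)`, where `s + t = 1`: Taylor
expansion in whichever of them is small.

Optimal angles. Each leading term is a factor depending on `β` times a function of `γ`; up to
constants, that function or its square is `u exp(-cu)` or `exp(-au) sinh(bu)` at `u = γ²`. Both rise
strictly to one peak and then fall strictly, which gives uniqueness and the first-local-optimum
property together (`isOptimalAngle_of_unimodal`). -/

/-- The eigenvalue `±1` of Pauli `Z` on a basis state. -/
def sgn (b : Bool) : ℝ := if b then -1 else 1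

lemma sgn_mul_self (b : Bool) : sgn b * sgn b = 1 := by cases b <;> simp [sgn]

lemma sgn_not (b : Bool) : sgn (!b) = -sgn b := by cases b <;> simp [sgn]

lemma abs_sgn (b : Bool) : |sgn b| = 1 := by cases b <;> simp [sgn]

section Circuit

variable {V : Type*}

/-- The eigenvalue of `Z_u Z_v` for `e = {u, v}`. -/
def pairSpin (z : V → Bool) (e : Sym2 V) : ℝ :=
  Sym2.lift ⟨fun u v => sgn (z u) * sgn (z v), fun _ _ => mul_comm _ _⟩ e

lemma pairSpin_mk (z : V → Bool) (u v : V) : pairSpin z s(u, v) = sgn (z u) * sgn (z v) := rfl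

variable [DecidableEq V]

/-- The basis state with bit `v` flipped. -/
def flip (v : V) (z : V → Bool) : V → Bool := Function.update z v (!(z v))

@[simp] lemma flip_self (v : V) (z : V → Bool) : flip v z v = !(z v) := by simp [flip]

lemma flip_of_ne {v w : V} (h : w ≠ v) (z : V → Bool) : flip v z w = z w := by simp [flip, h]

@[simp] lemma flip_flip (v : V) (z : V → Bool) : flip v (flip v z) = z := by
  ext w; by_cases h : w = v
  · subst h; simp
  · simp [flip_of_ne h]

lemma flip_comm (u v : V) (z : V → Bool) : flip u (flip v z) = flip v (flip u z) := by
  by_cases huv : u = v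
  · rw [huv]
  · ext w
    by_cases h : w = u
    · subst h; simp [flip_of_ne huv]
    · by_cases h' : w = v
      · subst h'; simp [flip_of_ne h]
      · simp [flip_of_ne h, flip_of_ne h']

lemma eq_flip_iff (v : V) (y z : V → Bool) : y = flip v z ↔ z = flip v y := by
  constructor <;> (rintro rfl; simp)

variable [Fintype V]

/-- The diagonal entries of the problem Hamiltonian. -/
def energy (G : SimpleGraph V) [DecidableRel G.Adj] (J : G.edgeSet → ℝ) (h : V → ℝ)
    (z : V → Bool) : ℝ :=
  ∑ e : G.edgeSet, J e * pairSpin z e + ∑ v : V, h v * sgn (z v)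

lemma pauliZ_eq {V : Type*} [Fintype V] (v : V) :
    pauliZ v = Matrix.diagonal fun z => ((sgn (z v) : ℝ) : ℂ) := by
  unfold pauliZ sgn
  congr 1; ext z; split_ifs <;> simp

lemma pauliZZ_mk (u v : V) : pauliZZ s(u, v) = pauliZ u * pauliZ v := rfl

lemma pauliZZ_eq (e : Sym2 V) :
    pauliZZ e = Matrix.diagonal fun z => ((pairSpin z e : ℝ) : ℂ) := by
  induction e using Sym2.ind with
  | _ u v =>
    rw [pauliZZ_mk, pauliZ_eq, pauliZ_eq, Matrix.diagonal_mul_diagonal]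
    simp [pairSpin_mk]

lemma pauliX_mulVec (v : V) (ψ : (V → Bool) → ℂ) (z : V → Bool) :
    (pauliX v).mulVec ψ z = ψ (flip v z) := by
  have : ∀ y : V → Bool, pauliX v z y = if y = flip v z then 1 else 0 := by
    intro y
    change (if z = flip v y then (1 : ℂ) else 0) = _
    simp only [eq_flip_iff v z y]
  simp [Matrix.mulVec, dotProduct, this]

lemma pauliZ_mulVec (v : V) (ψ : (V → Bool) → ℂ) (z : V → Bool) :
    (pauliZ v).mulVec ψ z = sgn (z v) * ψ z := by
  rw [pauliZ_eq, Matrix.mulVec_diagonal]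

/-- Operator identities are checked on states, where `X_v` flips a bit and `Z_v` multiplies by a
sign. -/
lemma op_ext {A B : Op V} (h : ∀ ψ z, A.mulVec ψ z = B.mulVec ψ z) : A = B :=
  Matrix.ext_of_mulVec_single fun _ => funext fun z => h _ z

lemma pauliX_mul_self (v : V) : pauliX v * pauliX v = (1 : Op V) :=
  op_ext fun ψ z => by simp [← Matrix.mulVec_mulVec, pauliX_mulVec]

lemma pauliZ_mul_self (v : V) : pauliZ v * pauliZ v = (1 : Op V) :=
  op_ext fun ψ z => by
    rw [← Matrix.mulVec_mulVec, pauliZ_mulVec, pauliZ_mulVec, ← mul_assoc,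
      ← Complex.ofReal_mul, sgn_mul_self]
    simp

lemma pauliX_commute (u v : V) : Commute (pauliX u) (pauliX v) :=
  op_ext fun ψ z => by
    simp only [← Matrix.mulVec_mulVec, pauliX_mulVec, flip_comm]

lemma pauliZ_mul_pauliX_self (v : V) : pauliZ v * pauliX v = -(pauliX v * pauliZ v) :=
  op_ext fun ψ z => by
    rw [Matrix.neg_mulVec]
    simp [← Matrix.mulVec_mulVec, pauliX_mulVec, pauliZ_mulVec, sgn_not]

lemma pauliZ_mul_pauliX_of_ne {u v : V} (h : u ≠ v) :
    pauliZ u * pauliX v = pauliX v * pauliZ u :=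
  op_ext fun ψ z => by
    simp [← Matrix.mulVec_mulVec, pauliX_mulVec, pauliZ_mulVec, flip_of_ne h]

lemma pauliX_conjTranspose (v : V) : (pauliX v).conjTranspose = pauliX v := by
  ext y z
  change star (if z = flip v y then (1 : ℂ) else 0) = if y = flip v z then (1 : ℂ) else 0
  simp only [eq_flip_iff v z y]
  split_ifs <;> simp

lemma problemHam_eq (G : SimpleGraph V) [DecidableRel G.Adj] (J : G.edgeSet → ℝ) (h : V → ℝ) :
    problemHam G J h = Matrix.diagonal fun z => ((energy G J h z : ℝ) : ℂ) :=
  op_ext fun ψ z => by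
    simp only [problemHam, pauliZZ_eq, pauliZ_eq, Matrix.add_mulVec, Matrix.sum_mulVec,
      Matrix.smul_mulVec, Matrix.mulVec_diagonal, Pi.add_apply, Finset.sum_apply, Pi.smul_apply,
      smul_eq_mul, energy]
    push_cast
    simp only [add_mul, Finset.sum_mul, mul_assoc]

/-- For the diagonal `Z` this is Euler's formula entry by entry, and `X` is conjugate to `Z`. -/
lemma exp_smul_pauliX (v : V) (t : ℂ) :
    NormedSpace.exp ((Complex.I * t) • pauliX v) =
      Complex.cos t • (1 : Op V) + (Complex.I * Complex.sin t) • pauliX v := by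
  have hZ : NormedSpace.exp ((Complex.I * t) • pauliZ v) =
      Complex.cos t • (1 : Op V) + (Complex.I * Complex.sin t) • pauliZ v := by
    rw [pauliZ_eq, ← Matrix.diagonal_smul, Matrix.exp_diagonal, ← Matrix.diagonal_one,
      ← Matrix.diagonal_smul, ← Matrix.diagonal_smul, Matrix.diagonal_add]
    congr 1; ext z
    rw [Pi.coe_exp]
    simp only [Pi.smul_apply, smul_eq_mul, ← Complex.exp_eq_exp_ℂ]
    cases hz : z v
    · simp [sgn, mul_comm Complex.I, Complex.exp_mul_I]
    · have : Complex.I * t * ((-1 : ℝ) : ℂ) = (-t) * Complex.I := by push_cast; ring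
      simp only [sgn, if_true]
      rw [this, Complex.exp_mul_I, Complex.cos_neg, Complex.sin_neg]
      push_cast; ring
  -- `P` is `√2` times the Hadamard gate, so `P² = 2` and `P` intertwines `X` and `Z`.
  set P : Op V := pauliX v + pauliZ v with hP
  have hPP : P * P = (2 : ℂ) • (1 : Op V) := by
    rw [hP, add_mul, mul_add, mul_add, pauliX_mul_self, pauliZ_mul_self, pauliZ_mul_pauliX_self,
      two_smul]
    abel
  have hPi : P * ((1 / 2 : ℂ) • P) = 1 := by
    rw [mul_smul_comm, hPP, smul_smul]; norm_num
  have hU : IsUnit P := IsUnit.of_mul_eq_one _ hPi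
  have hinv : P⁻¹ = (1 / 2 : ℂ) • P := Matrix.inv_eq_right_inv hPi
  have hZP : pauliZ v * P = P * pauliX v := by
    rw [hP, add_mul, mul_add, pauliX_mul_self, pauliZ_mul_self, add_comm]
  have hX : P⁻¹ * pauliZ v * P = pauliX v := by
    rw [mul_assoc, hZP, ← mul_assoc, hinv, smul_mul_assoc, hPP, smul_smul]; norm_num
  have h1 : P⁻¹ * P = 1 := by rw [hinv, smul_mul_assoc, hPP, smul_smul]; norm_num
  have hXs : ∀ c : ℂ, c • pauliX v = P⁻¹ * (c • pauliZ v) * P := by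
    intro c; rw [mul_smul_comm, smul_mul_assoc, hX]
  clear_value P
  rw [hXs, Matrix.exp_conj' P _ hU, hZ, mul_add, add_mul, ← hXs, mul_smul_comm, smul_mul_assoc,
    mul_one, h1]

/-! ### Conjugation of observables by the mixer -/

/-- The mixing unitary `exp(-i β H_M)`. -/
def mixer (V : Type*) [Fintype V] [DecidableEq V] (β : ℝ) : Op V :=
  NormedSpace.exp ((-(Complex.I * (β : ℂ))) • mixingHam V)

lemma mixer_unitary (β : ℝ) : (mixer V β).conjTranspose * mixer V β = 1 := by
  have hM : (mixingHam V).conjTranspose = mixingHam V := by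
    simp [mixingHam, Matrix.conjTranspose_sum, pauliX_conjTranspose]
  rw [mixer, ← Matrix.exp_conjTranspose, ← Matrix.exp_add_of_commute]
  · rw [Matrix.conjTranspose_smul, hM, ← add_smul]
    simp
  · rw [Matrix.conjTranspose_smul, hM]
    exact (Commute.refl _).smul_left _ |>.smul_right _

/-- `Z_u` anticommutes with `X_u` and commutes with every other `X_v`, so moving it past `H_M`
reverses one summand. -/
lemma pauliZ_mul_mixingHam (u : V) :
    pauliZ u * mixingHam V = (mixingHam V - (2 : ℂ) • pauliX u) * pauliZ u := by
  have h : ∀ v : V, pauliZ u * pauliX v =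
      pauliX v * pauliZ u - if v = u then (2 : ℂ) • (pauliX u * pauliZ u) else 0 := by
    intro v
    split_ifs with hv
    · subst hv; rw [pauliZ_mul_pauliX_self, two_smul]; abel
    · rw [pauliZ_mul_pauliX_of_ne (Ne.symm hv), sub_zero]
  rw [mixingHam, Finset.mul_sum, sub_mul, Finset.sum_mul, Finset.sum_congr rfl fun v _ => h v,
    Finset.sum_sub_distrib]
  simp

/-- Pauli `Z` in the Heisenberg picture of the mixer. -/
def heisZ (β : ℝ) (u : V) : Op V :=
  (Complex.cos (2 * β) • (1 : Op V) + (Complex.I * Complex.sin (2 * β)) • pauliX u) * pauliZ u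

/-- Conjugating the exponent by `Z_u` adds `2iβ X_u`, which commutes with `H_M`; the exponential
therefore splits off a single-qubit rotation. -/
lemma pauliZ_mul_mixer (β : ℝ) (u : V) : pauliZ u * mixer V β = mixer V β * heisZ β u := by
  have hU : IsUnit (pauliZ u) := IsUnit.of_mul_eq_one _ (pauliZ_mul_self u)
  have hinv : (pauliZ u)⁻¹ = pauliZ u := Matrix.inv_eq_right_inv (pauliZ_mul_self u)
  set t : ℂ := -(Complex.I * (β : ℂ)) with ht
  have h1 : pauliZ u * (t • mixingHam V) * (pauliZ u)⁻¹ =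
      t • mixingHam V + (Complex.I * (2 * β)) • pauliX u := by
    rw [hinv, mul_smul_comm, smul_mul_assoc, pauliZ_mul_mixingHam, mul_assoc, pauliZ_mul_self,
      mul_one, smul_sub, smul_smul, sub_eq_add_neg, ← neg_smul]
    congr 2
    rw [ht]; ring
  have hc : Commute (mixingHam V) (pauliX u) :=
    Commute.sum_left _ _ _ fun v _ => pauliX_commute v u
  have h2 := Matrix.exp_conj (pauliZ u) (t • mixingHam V) hU
  rw [h1, Matrix.exp_add_of_commute _ _ ((hc.smul_left _).smul_right _), exp_smul_pauliX,
    hinv] at h2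
  rw [mixer, heisZ, ← mul_assoc, h2, mul_assoc, pauliZ_mul_self, mul_one]

lemma heisZ_mulVec (β : ℝ) (u : V) (ψ : (V → Bool) → ℂ) (z : V → Bool) :
    (heisZ β u).mulVec ψ z = sgn (z u) *
      (Complex.cos (2 * β) * ψ z - Complex.I * Complex.sin (2 * β) * ψ (flip u z)) := by
  simp only [heisZ, ← Matrix.mulVec_mulVec, Matrix.add_mulVec, Matrix.smul_mulVec,
    Matrix.one_mulVec, Pi.add_apply, Pi.smul_apply, pauliZ_mulVec, pauliX_mulVec, smul_eq_mul,
    flip_self, sgn_not]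
  push_cast; ring

/-! ### Expectation values as spin averages of phases -/

/-- The state `exp(-i γ H_P) |s⟩`. -/
def phaseState (G : SimpleGraph V) [DecidableRel G.Adj] (J : G.edgeSet → ℝ) (h : V → ℝ)
    (γ : ℝ) : (V → Bool) → ℂ :=
  Matrix.mulVec (NormedSpace.exp ((-(Complex.I * (γ : ℂ))) • problemHam G J h)) (uniformState V)

lemma phaseState_apply (G : SimpleGraph V) [DecidableRel G.Adj] (J : G.edgeSet → ℝ) (h : V → ℝ)
    (γ : ℝ) (z : V → Bool) :
    phaseState G J h γ z = Complex.exp (-(Complex.I * γ * energy G J h z)) *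
      ((1 / Real.sqrt (2 ^ Fintype.card V) : ℝ) : ℂ) := by
  rw [phaseState, problemHam_eq, ← Matrix.diagonal_smul, Matrix.exp_diagonal,
    Matrix.mulVec_diagonal, Pi.coe_exp]
  simp only [Pi.smul_apply, smul_eq_mul, ← Complex.exp_eq_exp_ℂ, uniformState]
  congr 2; ring

/-- The relative phase `exp(i γ (C(y) - C(z)))` of two basis states. -/
def phase (G : SimpleGraph V) [DecidableRel G.Adj] (J : G.edgeSet → ℝ) (h : V → ℝ)
    (γ : ℝ) (y z : V → Bool) : ℂ :=
  Complex.exp (Complex.I * γ * (energy G J h y - energy G J h z))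

lemma star_phaseState_mul (G : SimpleGraph V) [DecidableRel G.Adj] (J : G.edgeSet → ℝ)
    (h : V → ℝ) (γ : ℝ) (y z : V → Bool) :
    star (phaseState G J h γ y) * phaseState G J h γ z =
      (1 / 2 ^ Fintype.card V) * phase G J h γ y z := by
  rw [phaseState_apply, phaseState_apply, phase, star_mul', Complex.star_def,
    Complex.conj_ofReal, ← Complex.exp_conj]
  have h2 : ((1 / Real.sqrt (2 ^ Fintype.card V) : ℝ) : ℂ) *
      ((1 / Real.sqrt (2 ^ Fintype.card V) : ℝ) : ℂ) = 1 / 2 ^ Fintype.card V := by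
    rw [← Complex.ofReal_mul, div_mul_div_comm, Real.mul_self_sqrt (by positivity)]
    push_cast; ring
  rw [mul_mul_mul_comm, h2, ← Complex.exp_add, mul_comm]
  congr 2
  simp
  ring

/-- The average of a function over all spin configurations. -/
def avg (F : (V → Bool) → ℂ) : ℂ := (1 / 2 ^ Fintype.card V) * ∑ z, F z

/-- The expectation value of the operator `A` in the QAOA state. -/
def expVal (G : SimpleGraph V) [DecidableRel G.Adj] (J : G.edgeSet → ℝ) (h : V → ℝ)
    (γ β : ℝ) (A : Op V) : ℂ :=
  dotProduct (star (qaoaState G J h γ β)) (A.mulVec (qaoaState G J h γ β))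

/-- The mixer is carried through the observable and cancels against its adjoint. -/
lemma expVal_of_mul_mixer (G : SimpleGraph V) [DecidableRel G.Adj] (J : G.edgeSet → ℝ)
    (h : V → ℝ) (γ β : ℝ) {A B : Op V} (hAB : A * mixer V β = mixer V β * B) :
    expVal G J h γ β A =
      dotProduct (star (phaseState G J h γ)) (B.mulVec (phaseState G J h γ)) := by
  have hs : qaoaState G J h γ β = (mixer V β).mulVec (phaseState G J h γ) := rfl
  rw [expVal, hs, Matrix.mulVec_mulVec, hAB, Matrix.star_mulVec, ← Matrix.dotProduct_mulVec,
    Matrix.mulVec_mulVec, ← mul_assoc, mixer_unitary, one_mul]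

lemma expVal_pauliZ (G : SimpleGraph V) [DecidableRel G.Adj] (J : G.edgeSet → ℝ) (h : V → ℝ)
    (γ β : ℝ) (v : V) :
    expVal G J h γ β (pauliZ v) = avg fun z => sgn (z v) *
      (Complex.cos (2 * β) -
        Complex.I * Complex.sin (2 * β) * phase G J h γ z (flip v z)) := by
  rw [expVal_of_mul_mixer G J h γ β (pauliZ_mul_mixer β v), dotProduct, avg, Finset.mul_sum]
  refine Finset.sum_congr rfl fun z _ => ?_
  have h0 := star_phaseState_mul G J h γ z z
  have h1 := star_phaseState_mul G J h γ z (flip v z)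
  have h2 : phase G J h γ z z = 1 := by simp [phase]
  rw [heisZ_mulVec, Pi.star_apply]
  rw [h2] at h0
  linear_combination (sgn (z v) * Complex.cos (2 * β) : ℂ) * h0 -
    (sgn (z v) * Complex.I * Complex.sin (2 * β) : ℂ) * h1

/-- The two conjugated operators act on different qubits, so their product has one term without a
flip, two with one flip, and one with both, whose sign is `i² = -1`. -/
lemma expVal_pauliZZ (G : SimpleGraph V) [DecidableRel G.Adj] (J : G.edgeSet → ℝ) (h : V → ℝ)
    (γ β : ℝ) {u v : V} (huv : u ≠ v) :
    expVal G J h γ β (pauliZZ s(u, v)) = avg fun z => ((sgn (z u) * sgn (z v) : ℝ) : ℂ) *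
      (Complex.cos (2 * β) ^ 2 -
        Complex.I * Complex.cos (2 * β) * Complex.sin (2 * β) *
          (phase G J h γ z (flip u z) + phase G J h γ z (flip v z)) -
        Complex.sin (2 * β) ^ 2 * phase G J h γ z (flip v (flip u z))) := by
  have hAB : pauliZZ s(u, v) * mixer V β = mixer V β * (heisZ β u * heisZ β v) := by
    rw [pauliZZ_mk, mul_assoc, pauliZ_mul_mixer, ← mul_assoc, pauliZ_mul_mixer, mul_assoc]
  rw [expVal_of_mul_mixer G J h γ β hAB, dotProduct, avg, Finset.mul_sum]
  refine Finset.sum_congr rfl fun z _ => ?_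
  have h0 := star_phaseState_mul G J h γ z z
  have h1 := star_phaseState_mul G J h γ z (flip u z)
  have h2 := star_phaseState_mul G J h γ z (flip v z)
  have h3 := star_phaseState_mul G J h γ z (flip v (flip u z))
  have h4 : phase G J h γ z z = 1 := by simp [phase]
  rw [← Matrix.mulVec_mulVec, heisZ_mulVec, heisZ_mulVec, heisZ_mulVec, Pi.star_apply,
    flip_of_ne huv.symm]
  rw [h4] at h0
  push_cast
  linear_combination (sgn (z u) * sgn (z v) * Complex.cos (2 * β) ^ 2 : ℂ) * h0 -
    (sgn (z u) * sgn (z v) * Complex.I * Complex.cos (2 * β) * Complex.sin (2 * β) : ℂ) *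
      (h1 + h2) + (sgn (z u) * sgn (z v) * Complex.I ^ 2 * Complex.sin (2 * β) ^ 2 : ℂ) * h3 +
    (sgn (z u) * sgn (z v) * (1 / 2 ^ Fintype.card V) * Complex.sin (2 * β) ^ 2 *
      phase G J h γ z (flip v (flip u z)) : ℂ) * Complex.I_sq

lemma qaoaCost_eq (G : SimpleGraph V) [DecidableRel G.Adj] (J : G.edgeSet → ℝ) (h : V → ℝ)
    (γ β : ℝ) :
    qaoaCost G J h γ β = ∑ e : G.edgeSet, ((J e : ℂ) * expVal G J h γ β (pauliZZ e)).re +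
      ∑ v : V, ((h v : ℂ) * expVal G J h γ β (pauliZ v)).re := by
  rw [qaoaCost, problemHam, Matrix.add_mulVec, dotProduct_add, Matrix.sum_mulVec,
    Matrix.sum_mulVec, dotProduct_sum, dotProduct_sum, Complex.add_re, Complex.re_sum,
    Complex.re_sum]
  simp only [Matrix.smul_mulVec, dotProduct_smul, smul_eq_mul, expVal]

end Circuit

/-! ### Expectations over the couplings and fields -/

/-- `𝔼[exp(i t X)]` for `X` with law `f`. -/
def cf (f : Measure ℝ) (t : ℝ) : ℂ := ∫ x, Complex.exp (Complex.I * t * x) ∂f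

/-- `𝔼[X exp(i t X)]` for `X` with law `f`. -/
def cf₁ (f : Measure ℝ) (t : ℝ) : ℂ := ∫ x, (x : ℂ) * Complex.exp (Complex.I * t * x) ∂f

/-- `𝔼[cos(t X)]` for `X` with law `f`. -/
def cosMean (f : Measure ℝ) (t : ℝ) : ℝ := ∫ x, Real.cos (t * x) ∂f

/-- `𝔼[sin(t X)]` for `X` with law `f`. -/
def sinMean (f : Measure ℝ) (t : ℝ) : ℝ := ∫ x, Real.sin (t * x) ∂f

/-- `𝔼[X sin(t X)]` for `X` with law `f`. -/
def mulSinMean (f : Measure ℝ) (t : ℝ) : ℝ := ∫ x, x * Real.sin (t * x) ∂f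

/-! ### Real and imaginary parts of the characteristic functions -/

section Moments

variable (f : Measure ℝ) [IsProbabilityMeasure f]

lemma integrable_cos (t : ℝ) : Integrable (fun x => Real.cos (t * x)) f :=
  Integrable.of_bound (by fun_prop) 1 (.of_forall fun x => by
    simpa using Real.abs_cos_le_one (t * x))

lemma integrable_sin (t : ℝ) : Integrable (fun x => Real.sin (t * x)) f :=
  Integrable.of_bound (by fun_prop) 1 (.of_forall fun x => by
    simpa using Real.abs_sin_le_one (t * x))

lemma integrable_mul_sin (hf : Integrable (fun x : ℝ => x) f) (t : ℝ) :
    Integrable (fun x => x * Real.sin (t * x)) f :=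
  hf.mul_bdd (c := 1) (by fun_prop) (.of_forall fun x => by
    simpa using Real.abs_sin_le_one (t * x))

lemma integrable_mul_cos (hf : Integrable (fun x : ℝ => x) f) (t : ℝ) :
    Integrable (fun x => x * Real.cos (t * x)) f :=
  hf.mul_bdd (c := 1) (by fun_prop) (.of_forall fun x => by
    simpa using Real.abs_cos_le_one (t * x))

lemma exp_I_mul (t x : ℝ) : Complex.exp (Complex.I * t * x) =
    (Real.cos (t * x) : ℂ) + (Real.sin (t * x) : ℂ) * Complex.I := by
  rw [show Complex.I * t * x = ((t * x : ℝ) : ℂ) * Complex.I by push_cast; ring,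
    Complex.exp_mul_I, Complex.ofReal_cos, Complex.ofReal_sin]

lemma cf_eq (t : ℝ) : cf f t = cosMean f t + sinMean f t * Complex.I := by
  simp only [cf, exp_I_mul]
  rw [integral_add (integrable_cos f t).ofReal ((integrable_sin f t).ofReal.mul_const _),
    integral_mul_const, integral_complex_ofReal, integral_complex_ofReal]
  rfl

lemma cf_neg (t : ℝ) : cf f (-t) = cosMean f t - sinMean f t * Complex.I := by
  rw [cf_eq]
  simp [cosMean, sinMean, integral_neg, sub_eq_add_neg]

lemma cosMean_neg (t : ℝ) : cosMean f (-t) = cosMean f t := by simp [cosMean]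

lemma sinMean_neg (t : ℝ) : sinMean f (-t) = -sinMean f t := by simp [sinMean, integral_neg]

lemma cosMean_zero : cosMean f 0 = 1 := by simp [cosMean]

lemma sinMean_zero : sinMean f 0 = 0 := by simp [sinMean]

@[simp] lemma cf_zero : cf f 0 = 1 := by simp [cf]

lemma cf₁_zero : cf₁ f 0 = m1 f := by
  simp only [cf₁, m1]
  rw [← integral_complex_ofReal]
  simp

/-- The spin average weighs `cf₁` by the sign of its argument, so only this odd part survives. -/
lemma cf₁_sub_cf₁_neg (hf : Integrable (fun x : ℝ => x) f) (t : ℝ) :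
    cf₁ f t - cf₁ f (-t) = 2 * mulSinMean f t * Complex.I := by
  have hI : ∀ s : ℝ, Integrable (fun x : ℝ => (x : ℂ) * Complex.exp (Complex.I * s * x)) f :=
    fun s => by
      simp only [exp_I_mul, mul_add, ← mul_assoc]
      exact_mod_cast (integrable_mul_cos f hf s).ofReal.add
        ((integrable_mul_sin f hf s).ofReal.mul_const _)
  rw [cf₁, cf₁, ← integral_sub (hI _) (hI _), mulSinMean, ← integral_complex_ofReal,
    ← integral_const_mul,
    ← integral_mul_const]
  refine integral_congr_ae (.of_forall fun x => ?_)
  simp only [exp_I_mul, neg_mul, Real.cos_neg, Real.sin_neg]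
  simp; ring

end Moments

/-! ### Factorisation over edges, vertices and independent weights -/

section Graph

variable {V : Type*} [Fintype V] [DecidableEq V]

/-- The edges at `u` are parametrised injectively by `w ↦ s(u, w)`; all other factors are trivial.
-/
lemma prod_edge_eq (G : SimpleGraph V) [DecidableRel G.Adj] (φ : Sym2 V → ℂ) (u : V)
    (hφ : ∀ e : Sym2 V, u ∉ e → φ e = 1) :
    ∏ e : G.edgeSet, φ e = ∏ w : V, if G.Adj u w then φ s(u, w) else 1 := by
  have h1 : ∏ e : G.edgeSet, φ e = ∏ e ∈ G.edgeFinset, φ e :=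
    (Finset.prod_subtype G.edgeFinset (fun e => SimpleGraph.mem_edgeFinset) φ).symm
  rw [Finset.prod_ite, Finset.prod_const_one, mul_one, h1]
  have hinj : Function.Injective fun w : V => s(u, w) := fun a b h => Sym2.congr_right.1 h
  rw [← Finset.prod_image (f := φ) hinj.injOn]
  symm
  refine Finset.prod_subset ?_ ?_
  · intro e he
    obtain ⟨w, hw, rfl⟩ := Finset.mem_image.1 he
    simpa using hw
  · intro e he hne
    refine hφ e fun hu => hne ?_
    obtain ⟨w, rfl⟩ := Sym2.mem_iff_exists.1 hu
    exact Finset.mem_image.2 ⟨w, by simpa using he, rfl⟩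

lemma prod_edge_eq_of_adj (G : SimpleGraph V) [DecidableRel G.Adj] (φ : Sym2 V → ℂ) {u v : V}
    (huv : G.Adj u v) (hφ : ∀ e : Sym2 V, u ∉ e → v ∉ e → φ e = 1) :
    ∏ e : G.edgeSet, φ e = φ s(u, v) * ∏ w ∈ ({u, v} : Finset V)ᶜ,
      ((if G.Adj u w then φ s(u, w) else 1) * (if G.Adj v w then φ s(v, w) else 1)) := by
  -- The edge `{u, v}` is assigned to `u` alone, so that splitting the product by endpoint does not
  -- count it twice.
  set φ₁ : Sym2 V → ℂ := fun e => if u ∈ e then φ e else 1 with h₁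
  set φ₂ : Sym2 V → ℂ := fun e => if u ∈ e then 1 else φ e with h₂
  have hφ₁₂ : ∀ e, φ e = φ₁ e * φ₂ e := fun e => by
    simp only [h₁, h₂]; split_ifs <;> simp
  simp only [Finset.prod_congr rfl fun (e : G.edgeSet) _ => hφ₁₂ e, Finset.prod_mul_distrib]
  rw [prod_edge_eq G φ₁ u fun e he => if_neg he, prod_edge_eq G φ₂ v fun e he => by
    by_cases hu : u ∈ e
    · exact if_pos hu
    · exact (if_neg hu).trans (hφ e hu he)]
  rw [← Finset.prod_mul_prod_compl {u, v} fun w => if G.Adj u w then φ₁ s(u, w) else 1,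
    ← Finset.prod_mul_prod_compl {u, v} fun w => if G.Adj v w then φ₂ s(v, w) else 1,
    Finset.prod_pair huv.ne, Finset.prod_pair huv.ne]
  have e2 : ∏ w ∈ ({u, v} : Finset V)ᶜ, (if G.Adj v w then φ₂ s(v, w) else 1) =
      ∏ w ∈ ({u, v} : Finset V)ᶜ, (if G.Adj v w then φ s(v, w) else 1) := by
    refine Finset.prod_congr rfl fun w hw => ?_
    have : u ≠ w ∧ u ≠ v := ⟨by rintro rfl; simp at hw, huv.ne⟩
    simp [h₂, this]
  rw [e2]
  simp only [h₁, h₂]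
  simp [huv, mul_assoc]

/-- Once the spins at `u` and `v` are fixed, the remaining spins are independent and uniform, so the
average of the product is the product of averages. -/
lemma avg_prod (u v : V) (huv : u ≠ v) (A : Bool → Bool → ℂ) (F : V → Bool → Bool → Bool → ℂ) :
    avg (fun z : V → Bool => A (z u) (z v) * ∏ w ∈ ({u, v} : Finset V)ᶜ, F w (z u) (z v) (z w)) =
      (1 / 4) * ∑ a, ∑ b, A a b * ∏ w ∈ ({u, v} : Finset V)ᶜ, ((1 / 2) * ∑ x, F w a b x) := by
  have hcard : (1 / 2 : ℂ) ^ Fintype.card V =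
      (1 / 4) * ∏ _w ∈ ({u, v} : Finset V)ᶜ, (1 / 2 : ℂ) := by
    rw [← Finset.card_univ, ← Finset.prod_const, ← Finset.prod_mul_prod_compl {u, v},
      Finset.prod_pair huv]
    norm_num
  have hsum : ∀ a b : Bool, ∑ z : V → Bool, (if z u = a then 1 else 0) * (if z v = b then 1 else 0)
      * ∏ w ∈ ({u, v} : Finset V)ᶜ, F w a b (z w) =
      ∏ w ∈ ({u, v} : Finset V)ᶜ, ∑ x, F w a b x := by
    intro a b
    -- The constraints `z u = a` and `z v = b` become indicator factors at `u` and `v`; the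
    -- constrained sum is then a full sum of products over `V`.
    let H : V → Bool → ℂ := fun w x => if w = u then (if x = a then 1 else 0) else
      if w = v then (if x = b then 1 else 0) else F w a b x
    have hH : ∀ w ∈ ({u, v} : Finset V)ᶜ, ∀ x, H w x = F w a b x := by
      intro w hw x
      simp only [Finset.mem_compl, Finset.mem_insert, Finset.mem_singleton, not_or] at hw
      simp [H, hw.1, hw.2]
    have h1 : ∀ z : V → Bool, ∏ w, H w (z w) = (if z u = a then 1 else 0) *
        (if z v = b then 1 else 0) * ∏ w ∈ ({u, v} : Finset V)ᶜ, F w a b (z w) := by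
      intro z
      rw [← Finset.prod_mul_prod_compl {u, v}, Finset.prod_pair huv,
        Finset.prod_congr rfl fun w hw => hH w hw (z w)]
      simp [H, huv.symm]
    have h2 := (Finset.prod_univ_sum (fun _ : V => (Finset.univ : Finset Bool)) H).symm
    rw [Fintype.piFinset_univ] at h2
    rw [← Finset.sum_congr rfl fun z _ => h1 z, h2, ← Finset.prod_mul_prod_compl {u, v},
      Finset.prod_pair huv,
      Finset.prod_congr rfl fun w hw => Finset.sum_congr rfl fun x _ => hH w hw x]
    simp [H, huv.symm]
  have hexp : ∀ z : V → Bool, A (z u) (z v) * ∏ w ∈ ({u, v} : Finset V)ᶜ, F w (z u) (z v) (z w) =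
      ∑ a, ∑ b, A a b * ((if z u = a then 1 else 0) * (if z v = b then 1 else 0) *
        ∏ w ∈ ({u, v} : Finset V)ᶜ, F w a b (z w)) := by
    intro z
    rw [Finset.sum_eq_single (z u) (by
      intro a _ ha
      exact Finset.sum_eq_zero fun b _ => by rw [if_neg ha.symm]; simp) (by simp),
      Finset.sum_eq_single (z v) (by
        intro b _ hb
        rw [if_neg hb.symm]; simp) (by simp)]
    simp
  rw [avg, ← one_div_pow, hcard, Finset.sum_congr rfl fun z _ => hexp z, Finset.sum_comm,
    mul_assoc, Finset.mul_sum]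
  congr 1
  refine Finset.sum_congr rfl fun a _ => ?_
  rw [Finset.sum_comm, Finset.mul_sum]
  refine Finset.sum_congr rfl fun b _ => ?_
  rw [← Finset.mul_sum, hsum, Finset.prod_mul_distrib]
  ring

variable (G : SimpleGraph V) [DecidableRel G.Adj] (f g : Measure ℝ)

lemma phase_eq_prod (J : G.edgeSet → ℝ) (h : V → ℝ) (γ : ℝ) (y z : V → Bool) :
    phase G J h γ y z =
      (∏ e : G.edgeSet, Complex.exp
        (Complex.I * ((γ * (pairSpin y e - pairSpin z e) : ℝ) : ℂ) * J e)) *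
      ∏ v : V, Complex.exp (Complex.I * ((γ * (sgn (y v) - sgn (z v)) : ℝ) : ℂ) * h v) := by
  rw [phase, ← Complex.exp_sum, ← Complex.exp_sum, ← Complex.exp_add]
  congr 1
  simp only [energy]
  push_cast
  rw [add_sub_add_comm, mul_add, ← Finset.sum_sub_distrib, ← Finset.sum_sub_distrib,
    Finset.mul_sum, Finset.mul_sum]
  congr 1 <;> refine Finset.sum_congr rfl fun _ _ => ?_ <;> ring

variable [IsProbabilityMeasure f] [IsProbabilityMeasure g]

/-- The phase is a product over single weights. The prefactor `J_{e₀}` is absorbed by the factor of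
`e₀`, which is why `cf₁` appears there and `cf` elsewhere. -/
lemma integral_mul_phase (e₀ : G.edgeSet) (γ : ℝ) (y z : V → Bool) :
    ∫ w : (G.edgeSet → ℝ) × (V → ℝ), (w.1 e₀ : ℂ) * phase G w.1 w.2 γ y z ∂(weightLaw G f g) =
      (∏ e : G.edgeSet, if (e : Sym2 V) = e₀ then cf₁ f (γ * (pairSpin y e - pairSpin z e))
        else cf f (γ * (pairSpin y e - pairSpin z e))) *
      ∏ v : V, cf g (γ * (sgn (y v) - sgn (z v))) := by
  let A : G.edgeSet → ℝ → ℂ := fun e x => (if (e : Sym2 V) = e₀ then (x : ℂ) else 1) *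
    Complex.exp (Complex.I * ((γ * (pairSpin y e - pairSpin z e) : ℝ) : ℂ) * x)
  let B : V → ℝ → ℂ := fun v x =>
    Complex.exp (Complex.I * ((γ * (sgn (y v) - sgn (z v)) : ℝ) : ℂ) * x)
  have key : ∀ w : (G.edgeSet → ℝ) × (V → ℝ), (w.1 e₀ : ℂ) * phase G w.1 w.2 γ y z =
      (∏ e, A e (w.1 e)) * ∏ v, B v (w.2 v) := by
    intro w
    simp only [phase_eq_prod, A, B, Finset.prod_mul_distrib, ← mul_assoc]
    simp [← Subtype.ext_iff]
  simp only [key, weightLaw]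
  rw [integral_prod_mul (fun J : G.edgeSet → ℝ => ∏ e, A e (J e))
    (fun h : V → ℝ => ∏ v, B v (h v)), integral_fintype_prod_eq_prod,
    integral_fintype_prod_eq_prod]
  congr 1
  refine Finset.prod_congr rfl fun e _ => ?_
  split_ifs with h <;> simp [A, h, cf, cf₁]

lemma continuous_phase (γ : ℝ) (y z : V → Bool) :
    Continuous fun w : (G.edgeSet → ℝ) × (V → ℝ) => phase G w.1 w.2 γ y z := by
  unfold phase energy
  fun_prop

lemma norm_phase (J : G.edgeSet → ℝ) (h : V → ℝ) (γ : ℝ) (y z : V → Bool) :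
    ‖phase G J h γ y z‖ = 1 := by
  rw [phase, Complex.norm_exp]
  simp

lemma integrable_coupling (hf : Integrable (fun x : ℝ => x) f) (e : G.edgeSet) :
    Integrable (fun w : (G.edgeSet → ℝ) × (V → ℝ) => (w.1 e : ℂ)) (weightLaw G f g) := by
  have h1 : Integrable (fun J : G.edgeSet → ℝ => J e) (Measure.pi fun _ => f) :=
    (measurePreserving_eval (fun _ : G.edgeSet => f) e).integrable_comp_of_integrable hf
  exact (h1.comp_fst _).ofReal

lemma integrable_field (hg : Integrable (fun x : ℝ => x) g) (v : V) :
    Integrable (fun w : (G.edgeSet → ℝ) × (V → ℝ) => w.2 v) (weightLaw G f g) := by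
  have h1 : Integrable (fun h : V → ℝ => h v) (Measure.pi fun _ => g) :=
    (measurePreserving_eval (fun _ : V => g) v).integrable_comp_of_integrable hg
  exact h1.comp_snd _

lemma integral_abs_field (v : V) :
    ∫ w : (G.edgeSet → ℝ) × (V → ℝ), |w.2 v| ∂(weightLaw G f g) = ∫ x, |x| ∂g := by
  have h : MeasurePreserving (fun w : (G.edgeSet → ℝ) × (V → ℝ) => w.2 v) (weightLaw G f g) g :=
    (measurePreserving_eval (fun _ : V => g) v).comp
      (measurePreserving_snd (μ := Measure.pi fun _ : G.edgeSet => f)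
        (ν := Measure.pi fun _ => g))
  have h2 := integral_map (μ := weightLaw G f g) (f := fun x : ℝ => |x|) h.measurable.aemeasurable (by fun_prop)
  rw [h.map_eq] at h2
  exact h2.symm

lemma integrable_mul_phase (hf : Integrable (fun x : ℝ => x) f) (e : G.edgeSet) (γ : ℝ)
    (y z : V → Bool) :
    Integrable (fun w : (G.edgeSet → ℝ) × (V → ℝ) => (w.1 e : ℂ) * phase G w.1 w.2 γ y z)
      (weightLaw G f g) := by
  have : IsProbabilityMeasure (weightLaw G f g) := by unfold weightLaw; infer_instance
  exact (integrable_coupling G f g hf e).mul_bdd (c := 1)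
    (continuous_phase G γ y z).aestronglyMeasurable
    (.of_forall fun w => (norm_phase G w.1 w.2 γ y z).le)

end Graph

/-! ### The exact mean of one edge term -/

section EdgeMean

variable {V : Type*} [Fintype V] [DecidableEq V]

lemma avg_add (F H : (V → Bool) → ℂ) : avg (fun z => F z + H z) = avg F + avg H := by
  simp only [avg, Finset.sum_add_distrib, mul_add]

lemma avg_sub (F H : (V → Bool) → ℂ) : avg (fun z => F z - H z) = avg F - avg H := by
  simp only [avg, Finset.sum_sub_distrib, mul_sub]

lemma avg_const_mul (c : ℂ) (F : (V → Bool) → ℂ) : avg (fun z => c * F z) = c * avg F := by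
  simp only [avg, ← Finset.mul_sum]; ring

lemma integrable_avg {Ω : Type*} [MeasurableSpace Ω] {P : Measure Ω}
    {F : Ω → (V → Bool) → ℂ} (hF : ∀ z, Integrable (fun ω => F ω z) P) :
    Integrable (fun ω => avg (F ω)) P :=
  (integrable_finsetSum _ fun z _ => hF z).const_mul _

lemma integral_avg {Ω : Type*} [MeasurableSpace Ω] {P : Measure Ω}
    {F : Ω → (V → Bool) → ℂ} (hF : ∀ z, Integrable (fun ω => F ω z) P) :
    ∫ ω, avg (F ω) ∂P = avg fun z => ∫ ω, F ω z ∂P := by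
  simp only [avg]
  rw [integral_const_mul, integral_finsetSum _ fun z _ => hF z]

variable (G : SimpleGraph V) [DecidableRel G.Adj]

/-- A vertex off the edge is adjacent to `u` only, to `v` only, to both or to neither, with factors
`X`, `Y`, `Z`, `1`. -/
lemma prod_compl_pair_eq_pow (u v : V) (X Y Z : ℂ) :
    ∏ w ∈ ({u, v} : Finset V)ᶜ, (if G.Adj u w then (if G.Adj v w then Z else X) else
      (if G.Adj v w then Y else 1)) =
      X ^ (nonTriangleNbrs G u v).card * Y ^ (nonTriangleNbrs G v u).card *
        Z ^ (triangleNbrs G u v).card := by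
  have hX : nonTriangleNbrs G u v =
      ({u, v} : Finset V)ᶜ.filter fun w => G.Adj u w ∧ ¬ G.Adj v w := by
    ext w
    simp only [nonTriangleNbrs, Finset.mem_erase, Finset.mem_sdiff, SimpleGraph.mem_neighborFinset,
      Finset.mem_filter, Finset.mem_compl, Finset.mem_insert, Finset.mem_singleton, not_or]
    exact ⟨fun h => ⟨⟨h.2.1.ne', h.1⟩, h.2⟩, fun h => ⟨h.1.2, h.2⟩⟩
  have hY : nonTriangleNbrs G v u =
      ({u, v} : Finset V)ᶜ.filter fun w => ¬ G.Adj u w ∧ G.Adj v w := by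
    ext w
    simp only [nonTriangleNbrs, Finset.mem_erase, Finset.mem_sdiff, SimpleGraph.mem_neighborFinset,
      Finset.mem_filter, Finset.mem_compl, Finset.mem_insert, Finset.mem_singleton, not_or]
    exact ⟨fun h => ⟨⟨h.1, h.2.1.ne'⟩, h.2.2, h.2.1⟩, fun h => ⟨h.1.1, h.2.2, h.2.1⟩⟩
  have hZ : triangleNbrs G u v =
      ({u, v} : Finset V)ᶜ.filter fun w => G.Adj u w ∧ G.Adj v w := by
    ext w
    simp only [triangleNbrs, Finset.mem_inter, SimpleGraph.mem_neighborFinset,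
      Finset.mem_filter, Finset.mem_compl, Finset.mem_insert, Finset.mem_singleton, not_or]
    exact ⟨fun h => ⟨⟨h.1.ne', h.2.ne'⟩, h⟩, fun h => h.2⟩
  rw [hX, hY, hZ, ← Finset.prod_const, ← Finset.prod_const, ← Finset.prod_const,
    Finset.prod_filter, Finset.prod_filter, Finset.prod_filter, ← Finset.prod_mul_distrib,
    ← Finset.prod_mul_distrib]
  refine Finset.prod_congr rfl fun w _ => ?_
  by_cases h1 : G.Adj u w <;> by_cases h2 : G.Adj v w <;> simp [h1, h2]

variable (f g : Measure ℝ) [IsProbabilityMeasure f] [IsProbabilityMeasure g]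

/-- The multipliers `p` and `q` encode the flips at `u` and `v`: `-1` if the spin is flipped, `1` if
not. This lets one computation serve all three flip patterns. Edges that miss both endpoints keep
their energy and drop out. -/
lemma integral_mul_phase_of_adj {u v : V} (huv : G.Adj u v) (γ : ℝ) {y z : V → Bool} {p q : ℝ}
    (hu : sgn (y u) = p * sgn (z u)) (hv : sgn (y v) = q * sgn (z v))
    (hy : ∀ w, w ≠ u → w ≠ v → y w = z w) :
    ∫ w : (G.edgeSet → ℝ) × (V → ℝ), (w.1 ⟨s(u, v), huv⟩ : ℂ) * phase G w.1 w.2 γ z y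
        ∂(weightLaw G f g) =
      cf₁ f (γ * (1 - p * q) * (sgn (z u) * sgn (z v))) * cf g (γ * (1 - p) * sgn (z u)) *
        cf g (γ * (1 - q) * sgn (z v)) * ∏ w ∈ ({u, v} : Finset V)ᶜ,
          ((if G.Adj u w then cf f (γ * (1 - p) * (sgn (z u) * sgn (z w))) else 1) *
            (if G.Adj v w then cf f (γ * (1 - q) * (sgn (z v) * sgn (z w))) else 1)) := by
  rw [integral_mul_phase, prod_edge_eq_of_adj G (fun e => if e = s(u, v) then
      cf₁ f (γ * (pairSpin z e - pairSpin y e)) else cf f (γ * (pairSpin z e - pairSpin y e))) huv]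
  · have hfield : ∏ w, cf g (γ * (sgn (z w) - sgn (y w))) =
        cf g (γ * (1 - p) * sgn (z u)) * cf g (γ * (1 - q) * sgn (z v)) := by
      rw [← Finset.prod_mul_prod_compl {u, v}, Finset.prod_pair huv.ne, hu, hv,
        Finset.prod_eq_one (s := ({u, v} : Finset V)ᶜ)]
      · rw [mul_one]; congr 2 <;> ring
      · intro w hw
        simp only [Finset.mem_compl, Finset.mem_insert, Finset.mem_singleton, not_or] at hw
        rw [hy w hw.1 hw.2]; simp
    have hprod : ∀ w ∈ ({u, v} : Finset V)ᶜ,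
        (if G.Adj u w then (if s(u, w) = s(u, v) then
          cf₁ f (γ * (pairSpin z s(u, w) - pairSpin y s(u, w))) else
            cf f (γ * (pairSpin z s(u, w) - pairSpin y s(u, w)))) else 1) *
        (if G.Adj v w then (if s(v, w) = s(u, v) then
          cf₁ f (γ * (pairSpin z s(v, w) - pairSpin y s(v, w))) else
            cf f (γ * (pairSpin z s(v, w) - pairSpin y s(v, w)))) else 1) =
        (if G.Adj u w then cf f (γ * (1 - p) * (sgn (z u) * sgn (z w))) else 1) *
            (if G.Adj v w then cf f (γ * (1 - q) * (sgn (z v) * sgn (z w))) else 1) := by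
      intro w hw
      simp only [Finset.mem_compl, Finset.mem_insert, Finset.mem_singleton, not_or] at hw
      have h1 : s(u, w) ≠ s(u, v) := by simp [hw.2, huv.ne]
      have h2 : s(v, w) ≠ s(u, v) := by simp [hw.1, huv.ne']
      rw [if_neg h1, if_neg h2]
      simp only [pairSpin_mk, hu, hv, hy w hw.1 hw.2]
      congr 3 <;> ring_nf
    rw [hfield, Finset.prod_congr rfl hprod, if_pos rfl, pairSpin_mk, pairSpin_mk, hu, hv]
    rw [show γ * (sgn (z u) * sgn (z v) - p * sgn (z u) * (q * sgn (z v))) =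
      γ * (1 - p * q) * (sgn (z u) * sgn (z v)) by ring]
    ring
  · intro e hue hve
    have hne : e ≠ s(u, v) := by rintro rfl; simp at hue
    rw [if_neg hne]
    have : pairSpin y e = pairSpin z e := by
      induction e using Sym2.ind with
      | _ a b =>
        simp only [Sym2.mem_iff, not_or] at hue hve
        rw [pairSpin_mk, pairSpin_mk, hy a (Ne.symm hue.1) (Ne.symm hve.1),
          hy b (Ne.symm hue.2) (Ne.symm hve.2)]
    rw [this]; simp

lemma avg_integral_mul_phase {u v : V} (huv : G.Adj u v) (γ : ℝ)
    {Y : (V → Bool) → V → Bool} {p q : ℝ}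
    (hu : ∀ z, sgn (Y z u) = p * sgn (z u)) (hv : ∀ z, sgn (Y z v) = q * sgn (z v))
    (hY : ∀ z w, w ≠ u → w ≠ v → Y z w = z w) :
    avg (fun z => ((sgn (z u) * sgn (z v) : ℝ) : ℂ) *
      ∫ w : (G.edgeSet → ℝ) × (V → ℝ), (w.1 ⟨s(u, v), huv⟩ : ℂ) * phase G w.1 w.2 γ z (Y z)
        ∂(weightLaw G f g)) =
    (1 / 4) * ∑ a, ∑ b, (((sgn a * sgn b : ℝ) : ℂ) *
      (cf₁ f (γ * (1 - p * q) * (sgn a * sgn b)) * cf g (γ * (1 - p) * sgn a) *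
        cf g (γ * (1 - q) * sgn b))) * ∏ w ∈ ({u, v} : Finset V)ᶜ, ((1 / 2) * ∑ x,
          ((if G.Adj u w then cf f (γ * (1 - p) * (sgn a * sgn x)) else 1) *
            (if G.Adj v w then cf f (γ * (1 - q) * (sgn b * sgn x)) else 1))) := by
  rw [← avg_prod u v huv.ne (fun a b => ((sgn a * sgn b : ℝ) : ℂ) *
      (cf₁ f (γ * (1 - p * q) * (sgn a * sgn b)) * cf g (γ * (1 - p) * sgn a) *
        cf g (γ * (1 - q) * sgn b))) (fun w a b x =>
          ((if G.Adj u w then cf f (γ * (1 - p) * (sgn a * sgn x)) else 1) *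
            (if G.Adj v w then cf f (γ * (1 - q) * (sgn b * sgn x)) else 1)))]
  congr 1; ext z
  rw [integral_mul_phase_of_adj G f g huv γ (hu z) (hv z) (hY z), ← mul_assoc]

/-- Only `u` is flipped, so neighbours of `v` alone contribute `1`, while each neighbour of `u`
averages the characteristic function over the two signs, leaving its real part. In the sum over the
two endpoint spins, the coupling keeps its odd part and the field at `u` its even part. -/
lemma avg_integral_flip_left (hf : Integrable (fun x : ℝ => x) f) {u v : V} (huv : G.Adj u v)
    (γ : ℝ) :
    avg (fun z => ((sgn (z u) * sgn (z v) : ℝ) : ℂ) *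
      ∫ w : (G.edgeSet → ℝ) × (V → ℝ), (w.1 ⟨s(u, v), huv⟩ : ℂ) *
        phase G w.1 w.2 γ z (flip u z) ∂(weightLaw G f g)) =
    Complex.I * (mulSinMean f (2 * γ) * cosMean g (2 * γ) *
      cosMean f (2 * γ) ^ ((nonTriangleNbrs G u v).card + (triangleNbrs G u v).card) : ℝ) := by
  rw [avg_integral_mul_phase G f g huv γ (p := -1) (q := 1)]
  · have hp : ∀ a b : Bool, ∏ w ∈ ({u, v} : Finset V)ᶜ, ((1 / 2) * ∑ x,
          ((if G.Adj u w then cf f (γ * (1 - (-1)) * (sgn a * sgn x)) else 1) *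
            (if G.Adj v w then cf f (γ * (1 - 1) * (sgn b * sgn x)) else 1))) =
        (cosMean f (2 * γ) : ℂ) ^
          ((nonTriangleNbrs G u v).card + (triangleNbrs G u v).card) := by
      intro a b
      have := prod_compl_pair_eq_pow G u v (cosMean f (2 * γ)) 1 (cosMean f (2 * γ))
      rw [one_pow, mul_one, ← pow_add] at this
      rw [← this]
      refine Finset.prod_congr rfl fun w _ => ?_
      have h2 : γ * (1 - (-1)) = 2 * γ := by ring
      have h3 : (2⁻¹ : ℂ) * (cf f (-(2 * γ)) + cf f (2 * γ)) = cosMean f (2 * γ) := by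
        rw [cf_neg, cf_eq]; ring
      have h4 : (2⁻¹ : ℂ) * (cf f (2 * γ) + cf f (-(2 * γ))) = cosMean f (2 * γ) := by
        rw [cf_neg, cf_eq]; ring
      rw [h2]
      split_ifs <;> cases a <;> simp [sgn] <;> first | exact h3 | exact h4
    simp only [hp, ← Finset.sum_mul]
    have h1 : γ * (1 - -1 * 1) = 2 * γ := by ring
    have h2 : γ * (1 - -1) = 2 * γ := by ring
    have h3 : cf₁ f (-(2 * γ)) = cf₁ f (2 * γ) - 2 * mulSinMean f (2 * γ) * Complex.I := by
      rw [← cf₁_sub_cf₁_neg f hf]; ring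
    simp only [Fintype.sum_bool, h1, h2]
    simp [sgn, h3, cf_eq g, cosMean_neg, sinMean_neg, cosMean_zero, sinMean_zero]
    ring
  · intro z; simp [sgn_not]
  · intro z; rw [flip_of_ne huv.ne']; simp
  · intro z w h _; exact flip_of_ne h z

lemma triangleNbrs_comm (u v : V) : triangleNbrs G u v = triangleNbrs G v u :=
  Finset.inter_comm _ _

lemma avg_integral_flip_right (hf : Integrable (fun x : ℝ => x) f) {u v : V} (huv : G.Adj u v)
    (γ : ℝ) :
    avg (fun z => ((sgn (z u) * sgn (z v) : ℝ) : ℂ) *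
      ∫ w : (G.edgeSet → ℝ) × (V → ℝ), (w.1 ⟨s(u, v), huv⟩ : ℂ) *
        phase G w.1 w.2 γ z (flip v z) ∂(weightLaw G f g)) =
    Complex.I * (mulSinMean f (2 * γ) * cosMean g (2 * γ) *
      cosMean f (2 * γ) ^ ((nonTriangleNbrs G v u).card + (triangleNbrs G u v).card) : ℝ) := by
  have he : (⟨s(v, u), huv.symm⟩ : G.edgeSet) = ⟨s(u, v), huv⟩ := Subtype.ext Sym2.eq_swap
  have h := avg_integral_flip_left G f g hf huv.symm γ
  simp only [he] at h
  rw [triangleNbrs_comm G u v, ← h]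
  congr 1; ext z
  rw [mul_comm (sgn (z u))]

/-- Flipping both ends leaves `Z_u Z_v` unchanged, so the edge itself contributes only its mean `cf₁
f 0`. A common neighbour contributes the average over `x` of `cf(2γ a x) cf(2γ b x)`: the real part
of `cf²` if the endpoint spins agree, and `|cf|²` if they differ. The two fields behave in the same
way. -/
lemma avg_integral_flip_both {u v : V} (huv : G.Adj u v) (γ : ℝ) :
    avg (fun z => ((sgn (z u) * sgn (z v) : ℝ) : ℂ) *
      ∫ w : (G.edgeSet → ℝ) × (V → ℝ), (w.1 ⟨s(u, v), huv⟩ : ℂ) *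
        phase G w.1 w.2 γ z (flip v (flip u z)) ∂(weightLaw G f g)) =
    (m1 f * cosMean f (2 * γ) ^ (nonTriangleNbrs G u v).card *
      cosMean f (2 * γ) ^ (nonTriangleNbrs G v u).card *
      ((1 / 2) * ((cosMean g (2 * γ) ^ 2 - sinMean g (2 * γ) ^ 2) *
          (cosMean f (2 * γ) ^ 2 - sinMean f (2 * γ) ^ 2) ^ (triangleNbrs G u v).card -
        (cosMean g (2 * γ) ^ 2 + sinMean g (2 * γ) ^ 2) *
          (cosMean f (2 * γ) ^ 2 + sinMean f (2 * γ) ^ 2) ^ (triangleNbrs G u v).card)) : ℝ) := by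
  rw [avg_integral_mul_phase G f g huv γ (p := -1) (q := -1)]
  · have hp : ∀ a b : Bool, ∏ w ∈ ({u, v} : Finset V)ᶜ, ((1 / 2) * ∑ x,
          ((if G.Adj u w then cf f (γ * (1 - (-1)) * (sgn a * sgn x)) else 1) *
            (if G.Adj v w then cf f (γ * (1 - (-1)) * (sgn b * sgn x)) else 1))) =
        (cosMean f (2 * γ) : ℂ) ^ (nonTriangleNbrs G u v).card *
          (cosMean f (2 * γ) : ℂ) ^ (nonTriangleNbrs G v u).card *
          ((cosMean f (2 * γ) ^ 2 - sgn a * sgn b * sinMean f (2 * γ) ^ 2 : ℝ) : ℂ) ^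
            (triangleNbrs G u v).card := by
      intro a b
      rw [← prod_compl_pair_eq_pow G u v]
      refine Finset.prod_congr rfl fun w _ => ?_
      have h2 : γ * (1 - (-1)) = 2 * γ := by ring
      rw [h2]
      split_ifs <;> cases a <;> cases b <;> simp [sgn, cf_neg, cf_eq f (2 * γ)] <;>
        ring_nf <;> simp <;> ring
    simp only [hp]
    have h1 : γ * (1 - -1 * -1) = 0 := by ring
    have h2 : γ * (1 - -1) = 2 * γ := by ring
    simp only [Fintype.sum_bool, h1, h2]
    simp [sgn, cf_eq g, cf₁_zero, cosMean_neg, sinMean_neg]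
    ring_nf
    simp
    ring
  · intro z; rw [flip_of_ne huv.ne]; simp [sgn_not]
  · intro z; simp [sgn_not, flip_of_ne huv.ne']
  · intro z w h h'; rw [flip_of_ne h', flip_of_ne h]

/-- The expectation of `J_{uv} ⟨Z_u Z_v⟩` for an edge with `m` common neighbours whose endpoints
each have `n` further neighbours. -/
def edgeMean (f g : Measure ℝ) (γ β : ℝ) (n m : ℕ) : ℝ :=
  Real.sin (4 * β) * mulSinMean f (2 * γ) * cosMean g (2 * γ) * cosMean f (2 * γ) ^ (n + m) -
    Real.sin (2 * β) ^ 2 * m1 f * cosMean f (2 * γ) ^ (2 * n) *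
      ((1 / 2) * ((cosMean g (2 * γ) ^ 2 - sinMean g (2 * γ) ^ 2) *
          (cosMean f (2 * γ) ^ 2 - sinMean f (2 * γ) ^ 2) ^ m -
        (cosMean g (2 * γ) ^ 2 + sinMean g (2 * γ) ^ 2) *
          (cosMean f (2 * γ) ^ 2 + sinMean f (2 * γ) ^ 2) ^ m))

lemma avg_sgn_mul_sgn {u v : V} (huv : u ≠ v) :
    avg (fun z : V → Bool => ((sgn (z u) * sgn (z v) : ℝ) : ℂ)) = 0 := by
  have := avg_prod u v huv (fun a b => ((sgn a * sgn b : ℝ) : ℂ)) (fun _ _ _ _ => 1)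
  simp only [Finset.prod_const_one, mul_one] at this
  rw [this]
  simp [sgn]

lemma mul_expVal_eq_avg {u v : V} (huv : G.Adj u v) (γ β : ℝ)
    (w : (G.edgeSet → ℝ) × (V → ℝ)) :
    (w.1 ⟨s(u, v), huv⟩ : ℂ) * expVal G w.1 w.2 γ β (pauliZZ s(u, v)) =
      avg fun z => ((sgn (z u) * sgn (z v) : ℝ) : ℂ) *
        (Complex.cos (2 * β) ^ 2 * w.1 ⟨s(u, v), huv⟩ -
          Complex.I * Complex.cos (2 * β) * Complex.sin (2 * β) *
            (w.1 ⟨s(u, v), huv⟩ * phase G w.1 w.2 γ z (flip u z) +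
              w.1 ⟨s(u, v), huv⟩ * phase G w.1 w.2 γ z (flip v z)) -
          Complex.sin (2 * β) ^ 2 *
            (w.1 ⟨s(u, v), huv⟩ * phase G w.1 w.2 γ z (flip v (flip u z)))) := by
  rw [expVal_pauliZZ G w.1 w.2 γ β huv.ne, ← avg_const_mul]
  congr 1; ext z; ring

lemma integrable_edge_integrand (hf : Integrable (fun x : ℝ => x) f) {u v : V} (huv : G.Adj u v)
    (γ β : ℝ) (z : V → Bool) :
    Integrable (fun w : (G.edgeSet → ℝ) × (V → ℝ) => ((sgn (z u) * sgn (z v) : ℝ) : ℂ) *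
        (Complex.cos (2 * β) ^ 2 * w.1 ⟨s(u, v), huv⟩ -
          Complex.I * Complex.cos (2 * β) * Complex.sin (2 * β) *
            (w.1 ⟨s(u, v), huv⟩ * phase G w.1 w.2 γ z (flip u z) +
              w.1 ⟨s(u, v), huv⟩ * phase G w.1 w.2 γ z (flip v z)) -
          Complex.sin (2 * β) ^ 2 *
            (w.1 ⟨s(u, v), huv⟩ * phase G w.1 w.2 γ z (flip v (flip u z))))) (weightLaw G f g) :=
  ((((integrable_coupling G f g hf _).const_mul _).sub
    (((integrable_mul_phase G f g hf _ γ _ _).add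
      (integrable_mul_phase G f g hf _ γ _ _)).const_mul _)).sub
    ((integrable_mul_phase G f g hf _ γ _ _).const_mul _)).const_mul _

lemma integrable_mul_expVal_pauliZZ (hf : Integrable (fun x : ℝ => x) f) (e : G.edgeSet)
    (γ β : ℝ) :
    Integrable (fun w : (G.edgeSet → ℝ) × (V → ℝ) =>
      (w.1 e : ℂ) * expVal G w.1 w.2 γ β (pauliZZ e)) (weightLaw G f g) := by
  obtain ⟨e, he⟩ := e
  induction e using Sym2.ind with
  | _ u v =>
    simp only [mul_expVal_eq_avg G he]
    exact integrable_avg fun z => integrable_edge_integrand G f g hf he γ β z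

lemma integral_mul_expVal_pauliZZ (hf : Integrable (fun x : ℝ => x) f) {u v : V}
    (huv : G.Adj u v) (γ β : ℝ) {n m : ℕ} (hn : (nonTriangleNbrs G u v).card = n)
    (hn' : (nonTriangleNbrs G v u).card = n) (hm : (triangleNbrs G u v).card = m) :
    ∫ w : (G.edgeSet → ℝ) × (V → ℝ),
      (w.1 ⟨s(u, v), huv⟩ : ℂ) * expVal G w.1 w.2 γ β (pauliZZ s(u, v)) ∂(weightLaw G f g) =
      (edgeMean f g γ β n m : ℂ) := by
  simp only [mul_expVal_eq_avg G huv]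
  rw [integral_avg fun z => integrable_edge_integrand G f g hf huv γ β z]
  set I₀ : ℂ := ∫ w : (G.edgeSet → ℝ) × (V → ℝ), (w.1 ⟨s(u, v), huv⟩ : ℂ) ∂(weightLaw G f g)
  have hz : ∀ z : V → Bool, ∫ w : (G.edgeSet → ℝ) × (V → ℝ), ((sgn (z u) * sgn (z v) : ℝ) : ℂ) *
        (Complex.cos (2 * β) ^ 2 * w.1 ⟨s(u, v), huv⟩ -
          Complex.I * Complex.cos (2 * β) * Complex.sin (2 * β) *
            (w.1 ⟨s(u, v), huv⟩ * phase G w.1 w.2 γ z (flip u z) +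
              w.1 ⟨s(u, v), huv⟩ * phase G w.1 w.2 γ z (flip v z)) -
          Complex.sin (2 * β) ^ 2 *
            (w.1 ⟨s(u, v), huv⟩ * phase G w.1 w.2 γ z (flip v (flip u z)))) ∂(weightLaw G f g) =
      Complex.cos (2 * β) ^ 2 * I₀ * ((sgn (z u) * sgn (z v) : ℝ) : ℂ) -
        Complex.I * Complex.cos (2 * β) * Complex.sin (2 * β) *
          (((sgn (z u) * sgn (z v) : ℝ) : ℂ) * (∫ w : (G.edgeSet → ℝ) × (V → ℝ),
            (w.1 ⟨s(u, v), huv⟩ : ℂ) * phase G w.1 w.2 γ z (flip u z) ∂(weightLaw G f g)) +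
          ((sgn (z u) * sgn (z v) : ℝ) : ℂ) * (∫ w : (G.edgeSet → ℝ) × (V → ℝ),
            (w.1 ⟨s(u, v), huv⟩ : ℂ) * phase G w.1 w.2 γ z (flip v z) ∂(weightLaw G f g))) -
        Complex.sin (2 * β) ^ 2 * (((sgn (z u) * sgn (z v) : ℝ) : ℂ) *
          (∫ w : (G.edgeSet → ℝ) × (V → ℝ), (w.1 ⟨s(u, v), huv⟩ : ℂ) *
            phase G w.1 w.2 γ z (flip v (flip u z)) ∂(weightLaw G f g))) := by
    intro z
    have i₀ := integrable_coupling G f g hf ⟨s(u, v), huv⟩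
    have i₁ := integrable_mul_phase G f g hf ⟨s(u, v), huv⟩ γ z (flip u z)
    have i₂ := integrable_mul_phase G f g hf ⟨s(u, v), huv⟩ γ z (flip v z)
    have i₃ := integrable_mul_phase G f g hf ⟨s(u, v), huv⟩ γ z (flip v (flip u z))
    have i₁₂ : Integrable (fun w : (G.edgeSet → ℝ) × (V → ℝ) =>
      (w.1 ⟨s(u, v), huv⟩ : ℂ) * phase G w.1 w.2 γ z (flip u z) +
        w.1 ⟨s(u, v), huv⟩ * phase G w.1 w.2 γ z (flip v z)) (weightLaw G f g) := i₁.add i₂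
    rw [integral_const_mul, integral_sub _ (i₃.const_mul _), integral_sub (i₀.const_mul _)
      (i₁₂.const_mul _), integral_const_mul, integral_const_mul, integral_const_mul,
      integral_add i₁ i₂]
    · ring
    · exact (i₀.const_mul _).sub (i₁₂.const_mul _)
  simp only [hz]
  rw [avg_sub, avg_sub, avg_const_mul, avg_const_mul, avg_const_mul, avg_add,
    avg_sgn_mul_sgn huv.ne, avg_integral_flip_left G f g hf huv,
    avg_integral_flip_right G f g hf huv, avg_integral_flip_both G f g huv, hn, hn', hm, edgeMean,
    show (4 : ℝ) * β = 2 * (2 * β) by ring, Real.sin_two_mul (2 * β)]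
  push_cast
  linear_combination (-2 * Complex.cos (2 * β) * Complex.sin (2 * β) *
    (mulSinMean f (2 * γ) * cosMean g (2 * γ) * cosMean f (2 * γ) ^ (n + m)) : ℂ) * Complex.I_sq

end EdgeMean

/-! ### From one edge to the whole graph -/

section ScaledCost

variable {V : Type*} [Fintype V] [DecidableEq V]

/-- The crude bound `|cos| + |sin| ≤ 2` suffices, because the fields enter only the error term. -/
lemma norm_expVal_pauliZ_le (G : SimpleGraph V) [DecidableRel G.Adj] (J : G.edgeSet → ℝ)
    (h : V → ℝ) (γ β : ℝ) (v : V) : ‖expVal G J h γ β (pauliZ v)‖ ≤ 2 := by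
  have hterm : ∀ z : V → Bool, ‖(sgn (z v) : ℂ) * (Complex.cos (2 * β) -
      Complex.I * Complex.sin (2 * β) * phase G J h γ z (flip v z))‖ ≤ 2 := by
    intro z
    have hc : ‖Complex.cos (2 * β)‖ ≤ 1 := by
      rw [show (2 * β : ℂ) = ((2 * β : ℝ) : ℂ) by push_cast; ring, ← Complex.ofReal_cos,
        Complex.norm_real]
      exact Real.abs_cos_le_one _
    have hs : ‖Complex.sin (2 * β)‖ ≤ 1 := by
      rw [show (2 * β : ℂ) = ((2 * β : ℝ) : ℂ) by push_cast; ring, ← Complex.ofReal_sin,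
        Complex.norm_real]
      exact Real.abs_sin_le_one _
    rw [norm_mul, Complex.norm_real, Real.norm_eq_abs, abs_sgn, one_mul]
    refine (norm_sub_le _ _).trans ?_
    rw [norm_mul, norm_mul, norm_phase, Complex.norm_I]
    linarith
  rw [expVal_pauliZ, avg, norm_mul]
  have h2 : ‖(1 / 2 ^ Fintype.card V : ℂ)‖ = 1 / 2 ^ Fintype.card V := by simp
  rw [h2]
  calc _ ≤ 1 / 2 ^ Fintype.card V * (∑ _z : V → Bool, (2 : ℝ)) := by
        gcongr
        exact norm_sum_le_of_le _ fun z _ => hterm z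
    _ = 2 := by simp [Fintype.card_pi]

variable (G : SimpleGraph V) [DecidableRel G.Adj]

lemma continuous_expVal_pauliZ (γ β : ℝ) (v : V) :
    Continuous fun w : (G.edgeSet → ℝ) × (V → ℝ) => expVal G w.1 w.2 γ β (pauliZ v) := by
  simp only [expVal_pauliZ, avg]
  have := fun z : V → Bool => continuous_phase G γ z (flip v z)
  fun_prop

variable (f g : Measure ℝ) [IsProbabilityMeasure f] [IsProbabilityMeasure g]

instance : IsProbabilityMeasure (weightLaw G f g) := by unfold weightLaw; infer_instance

lemma integrable_mul_expVal_pauliZ (hg : Integrable (fun x : ℝ => x) g) (γ β : ℝ) (v : V) :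
    Integrable (fun w : (G.edgeSet → ℝ) × (V → ℝ) =>
      (w.2 v : ℂ) * expVal G w.1 w.2 γ β (pauliZ v)) (weightLaw G f g) :=
  (integrable_field G f g hg v).ofReal.mul_bdd (c := 2)
    (continuous_expVal_pauliZ G γ β v).aestronglyMeasurable
    (.of_forall fun w => norm_expVal_pauliZ_le G w.1 w.2 γ β v)

lemma abs_integral_field_le (hg : Integrable (fun x : ℝ => x) g) (γ β : ℝ) (v : V) :
    |∫ w : (G.edgeSet → ℝ) × (V → ℝ), ((w.2 v : ℂ) * expVal G w.1 w.2 γ β (pauliZ v)).re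
      ∂(weightLaw G f g)| ≤ 2 * ∫ x, |x| ∂g := by
  rw [← integral_abs_field G f g v, ← integral_const_mul, ← Real.norm_eq_abs]
  refine norm_integral_le_of_norm_le ((integrable_field G f g hg v).abs.const_mul _)
    (.of_forall fun w => ?_)
  rw [Real.norm_eq_abs]
  refine (Complex.abs_re_le_norm _).trans ?_
  rw [norm_mul, Complex.norm_real, Real.norm_eq_abs, mul_comm]
  gcongr
  exact norm_expVal_pauliZ_le G w.1 w.2 γ β v

lemma integrable_qaoaCost (hf : Integrable (fun x : ℝ => x) f)
    (hg : Integrable (fun x : ℝ => x) g) (γ β : ℝ) :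
    Integrable (fun w : (G.edgeSet → ℝ) × (V → ℝ) => qaoaCost G w.1 w.2 γ β)
      (weightLaw G f g) := by
  simp only [qaoaCost_eq]
  exact (integrable_finsetSum _ fun e _ =>
      (integrable_mul_expVal_pauliZZ G f g hf e γ β).re).add
    (integrable_finsetSum _ fun v _ => (integrable_mul_expVal_pauliZ G f g hg γ β v).re)

lemma card_add_card_add_one {u v : V} (huv : G.Adj u v) :
    (nonTriangleNbrs G u v).card + (triangleNbrs G u v).card + 1 = G.degree u := by
  have hv : v ∈ G.neighborFinset u \ G.neighborFinset v := by simp [huv]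
  have h1 := Finset.card_erase_add_one hv
  have h2 := Finset.card_sdiff_add_card_inter (G.neighborFinset u) (G.neighborFinset v)
  rw [SimpleGraph.card_neighborFinset_eq_degree] at h2
  simp only [nonTriangleNbrs, triangleNbrs]
  omega

/-- All edges have the same counts and hence the same mean, so the coupling part is exact. The error
comes from the fields: at most `2 𝔼|h|` per vertex, with `|V|/|E| = 2/(D+1)` by regularity. -/
lemma scaledExpectedCost_sub_edgeMean_le [Nonempty V] (hf : Integrable (fun x : ℝ => x) f)
    (hg : Integrable (fun x : ℝ => x) g) {D : ℕ} {a b lam μ : ℝ}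
    (hG : HasCounts G D a b lam μ) :
    ∃ n m : ℕ, (n : ℝ) = a * (D : ℝ) ^ lam ∧ (m : ℝ) = b * (D : ℝ) ^ μ ∧ n + m = D ∧
      ∀ γ β : ℝ, |scaledExpectedCost G f g γ β - edgeMean f g γ β n m| ≤
        4 * (∫ x, |x| ∂g) / (D + 1) := by
  obtain ⟨hreg, hcounts⟩ := hG
  obtain ⟨u₀⟩ := ‹Nonempty V›
  obtain ⟨v₀, huv₀⟩ : ∃ v₀, G.Adj u₀ v₀ := by
    have : 0 < G.degree u₀ := by rw [hreg u₀]; omega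
    exact (G.degree_pos_iff_exists_adj u₀).1 this
  have hc₀ := hcounts u₀ v₀ huv₀
  have hD := card_add_card_add_one G huv₀
  rw [hreg u₀] at hD
  refine ⟨_, _, hc₀.1, hc₀.2, by omega, fun γ β => ?_⟩
  set n := (nonTriangleNbrs G u₀ v₀).card
  set m := (triangleNbrs G u₀ v₀).card
  have hn : ∀ u v, G.Adj u v → (nonTriangleNbrs G u v).card = n := fun u v h => by
    have := (hcounts u v h).1.trans hc₀.1.symm
    exact_mod_cast this
  have hm : ∀ u v, G.Adj u v → (triangleNbrs G u v).card = m := fun u v h => by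
    have := (hcounts u v h).2.trans hc₀.2.symm
    exact_mod_cast this
  have hedge : ∀ e : G.edgeSet, ∫ w : (G.edgeSet → ℝ) × (V → ℝ),
      ((w.1 e : ℂ) * expVal G w.1 w.2 γ β (pauliZZ e)).re ∂(weightLaw G f g) =
      edgeMean f g γ β n m := by
    rintro ⟨e, he⟩
    have hre := integral_re (integrable_mul_expVal_pauliZZ G f g hf ⟨e, he⟩ γ β)
    simp only [RCLike.re_eq_complex_re] at hre
    rw [hre]
    induction e using Sym2.ind with
    | _ u v =>
      rw [integral_mul_expVal_pauliZZ G f g hf he γ β (hn u v he) (hn v u (SimpleGraph.Adj.symm he)) (hm u v he),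
        Complex.ofReal_re]
  have hE : 2 * (G.edgeFinset.card : ℝ) = Fintype.card V * (D + 1) := by
    have := G.sum_degrees_eq_twice_card_edges
    simp only [hreg.degree_eq, Finset.sum_const, Finset.card_univ, smul_eq_mul] at this
    exact_mod_cast this.symm
  have hV : 0 < (Fintype.card V : ℝ) := by
    exact_mod_cast Fintype.card_pos_iff.2 ⟨u₀⟩
  have hEpos : 0 < (G.edgeFinset.card : ℝ) := by
    have : 0 < (Fintype.card V : ℝ) * (D + 1) := by positivity
    linarith
  have hint : ∫ w, qaoaCost G w.1 w.2 γ β ∂(weightLaw G f g) =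
      G.edgeFinset.card * edgeMean f g γ β n m + ∑ v : V, ∫ w : (G.edgeSet → ℝ) × (V → ℝ),
        ((w.2 v : ℂ) * expVal G w.1 w.2 γ β (pauliZ v)).re ∂(weightLaw G f g) := by
    simp only [qaoaCost_eq]
    have h1 : ∀ e : G.edgeSet, Integrable (fun w : (G.edgeSet → ℝ) × (V → ℝ) =>
        ((w.1 e : ℂ) * expVal G w.1 w.2 γ β (pauliZZ e)).re) (weightLaw G f g) :=
      fun e => (integrable_mul_expVal_pauliZZ G f g hf e γ β).re
    have h2 : ∀ v : V, Integrable (fun w : (G.edgeSet → ℝ) × (V → ℝ) =>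
        ((w.2 v : ℂ) * expVal G w.1 w.2 γ β (pauliZ v)).re) (weightLaw G f g) :=
      fun v => (integrable_mul_expVal_pauliZ G f g hg γ β v).re
    rw [integral_add (integrable_finsetSum _ fun e _ => h1 e)
      (integrable_finsetSum _ fun v _ => h2 v), integral_finsetSum _ fun e _ => h1 e,
      integral_finsetSum _ fun v _ => h2 v, Finset.sum_congr rfl fun e _ => hedge e]
    rw [Finset.sum_const, Finset.card_univ, SimpleGraph.edgeFinset_card, nsmul_eq_mul]
  rw [scaledExpectedCost, hint, mul_add, ← mul_assoc, one_div_mul_cancel hEpos.ne', one_mul,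
    add_sub_cancel_left, abs_mul, abs_of_pos (by positivity)]
  have hsum : |∑ v : V, ∫ w : (G.edgeSet → ℝ) × (V → ℝ),
      ((w.2 v : ℂ) * expVal G w.1 w.2 γ β (pauliZ v)).re ∂(weightLaw G f g)| ≤
      Fintype.card V * (2 * ∫ x, |x| ∂g) := by
    refine (Finset.abs_sum_le_sum_abs _ _).trans ?_
    refine (Finset.sum_le_sum fun v _ => abs_integral_field_le G f g hg γ β v).trans ?_
    simp
  calc _ ≤ 1 / (G.edgeFinset.card : ℝ) * (Fintype.card V * (2 * ∫ x, |x| ∂g)) := by gcongr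
    _ = 4 * (∫ x, |x| ∂g) / (D + 1) := by
      have : (G.edgeFinset.card : ℝ) = Fintype.card V * (D + 1) / 2 := by linarith
      rw [this]; field_simp; ring

end ScaledCost

/-! ### Small-angle asymptotics -/

/-- The bound has to hold for every real `x`, since it is integrated against an unbounded variable;
for `|x| > 1` the quadratic term is itself below `x⁴`. -/
lemma abs_cos_sub_le (x : ℝ) : |Real.cos x - (1 - x ^ 2 / 2)| ≤ 3 * x ^ 4 := by
  rcases le_or_gt |x| 1 with h | h
  · refine (Real.cos_bound h).trans ?_
    have : |x| ^ 4 = x ^ 4 := by rw [← abs_pow]; exact abs_of_nonneg (by positivity)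
    rw [this]
    nlinarith [sq_nonneg (x ^ 2)]
  · have h1 : 1 ≤ x ^ 2 := by rw [← sq_abs]; nlinarith
    have h2 : x ^ 2 ≤ x ^ 4 := by nlinarith
    rw [abs_of_nonneg (by linarith [Real.one_sub_sq_div_two_le_cos (x := x)])]
    linarith [Real.cos_le_one x]

lemma abs_sin_sub_le (x : ℝ) : |Real.sin x - x| ≤ |x| ^ 3 := by
  have key : ∀ y : ℝ, 0 ≤ y → |Real.sin y - y| ≤ y ^ 3 := fun y hy => by
    rw [abs_le]
    have : 0 ≤ y ^ 3 := by positivity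
    constructor <;> linarith [Real.sin_ge_sub_cube hy, Real.sin_le hy]
  rcases le_total 0 x with h | h
  · simpa [abs_of_nonneg h] using key x h
  · have := key (-x) (by linarith)
    rw [Real.sin_neg, neg_sub_neg, abs_sub_comm] at this
    rwa [abs_of_nonpos h]

lemma abs_exp_neg_sub_le {y : ℝ} (hy : 0 ≤ y) : |Real.exp (-y) - (1 - y)| ≤ y ^ 2 := by
  have h1 := Real.add_one_le_exp (-y)
  have h2 := Real.add_one_le_exp y
  have h3 : Real.exp (-y) * Real.exp y = 1 := by rw [← Real.exp_add]; simp
  rw [abs_of_nonneg (by linarith)]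
  have h4 : Real.exp (-y) * (1 + y) ≤ 1 := by
    rw [← h3]; gcongr; linarith
  -- The contradiction is `(1 + y)(1 - y + y²) = 1 + y³ ≥ 1`.
  by_contra h
  push Not at h
  nlinarith [pow_nonneg hy 3]

lemma abs_mul_sub_mul_le {a a' b b' : ℝ} (ha : |a| ≤ 1) (hb : |b'| ≤ 1) :
    |a * b - a' * b'| ≤ |a - a'| + |b - b'| := by
  rw [show a * b - a' * b' = (a - a') * b' + a * (b - b') by ring]
  refine (abs_add_le _ _).trans ?_
  rw [abs_mul, abs_mul]
  gcongr
  · exact mul_le_of_le_one_right (abs_nonneg _) hb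
  · exact mul_le_of_le_one_left (abs_nonneg _) ha

/-- Inside the unit interval the error grows only linearly in the exponent. -/
lemma abs_pow_sub_pow_le_mul {x y : ℝ} (hx : |x| ≤ 1) (hy : |y| ≤ 1) (n : ℕ) :
    |x ^ n - y ^ n| ≤ n * |x - y| := by
  refine (abs_pow_sub_pow_le x y n).trans ?_
  rw [mul_comm (n : ℝ)]
  refine mul_le_of_le_one_right (by positivity) (pow_le_one₀ (by positivity) (max_le hx hy))

/-! ### Taylor bounds for the characteristic functions -/

section Moments

variable {f : Measure ℝ} [IsProbabilityMeasure f]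

lemma integrable_pow_four (hf : MemLp (fun x : ℝ => x) 4 f) :
    Integrable (fun x : ℝ => x ^ 4) f := by
  have := hf.integrable_norm_pow (p := 4) (by norm_num)
  refine this.congr (.of_forall fun x => ?_)
  simp only [Real.norm_eq_abs, ← abs_pow]
  exact abs_of_nonneg (by positivity)

lemma integrable_abs_pow_three (hf : MemLp (fun x : ℝ => x) 4 f) :
    Integrable (fun x : ℝ => |x| ^ 3) f := by
  refine ((integrable_const (1 : ℝ)).add (integrable_pow_four hf)).mono' (by fun_prop)
    (.of_forall fun x => ?_)
  simp only [Pi.add_apply, Real.norm_eq_abs, abs_pow, abs_abs]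
  have h4 : x ^ 4 = |x| ^ 4 := by rw [← abs_pow]; exact (abs_of_nonneg (by positivity)).symm
  rw [h4]
  rcases le_total |x| 1 with h | h
  · have : |x| ^ 3 ≤ 1 := pow_le_one₀ (abs_nonneg _) h
    have : 0 ≤ |x| ^ 4 := by positivity
    linarith
  · have : |x| ^ 3 ≤ |x| ^ 4 := pow_le_pow_right₀ h (by norm_num)
    linarith

lemma integrable_sq (hf : MemLp (fun x : ℝ => x) 2 f) : Integrable (fun x : ℝ => x ^ 2) f :=
  hf.integrable_sq

lemma m2_nonneg (f : Measure ℝ) : 0 ≤ m2 f := integral_nonneg fun x => sq_nonneg x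

lemma m1_sq_le_m2 (hf : MemLp (fun x : ℝ => x) 2 f) : m1 f ^ 2 ≤ m2 f := by
  have h1 : Integrable (fun x : ℝ => x) f := hf.integrable (by norm_num)
  have h : 0 ≤ ∫ x, (x - m1 f) ^ 2 ∂f := integral_nonneg fun x => sq_nonneg _
  have h2 : ∫ x, (x - m1 f) ^ 2 ∂f = m2 f - m1 f ^ 2 := by
    have : ∀ x : ℝ, (x - m1 f) ^ 2 = x ^ 2 - 2 * m1 f * x + m1 f ^ 2 := fun x => by ring
    simp only [this]
    have h3 : Integrable (fun x : ℝ => x ^ 2 - 2 * m1 f * x) f :=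
      (integrable_sq hf).sub (h1.const_mul _)
    rw [integral_add h3 (integrable_const _),
      integral_sub (integrable_sq hf) (h1.const_mul _), integral_const_mul]
    have e1 : ∫ x, x ∂f = m1 f := rfl
    have e2 : ∫ x, x ^ 2 ∂f = m2 f := rfl
    rw [e1, e2]
    simp
    ring
  linarith

lemma abs_integral_sub_le {F H B : ℝ → ℝ} (hF : Integrable F f) (hH : Integrable H f)
    (hB : Integrable B f) (h : ∀ x, |F x - H x| ≤ B x) :
    |∫ x, F x ∂f - ∫ x, H x ∂f| ≤ ∫ x, B x ∂f := by
  rw [← integral_sub hF hH, ← Real.norm_eq_abs]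
  exact norm_integral_le_of_norm_le hB (.of_forall h)

lemma abs_cosMean_sub_le (hf : MemLp (fun x : ℝ => x) 4 f) (t : ℝ) :
    |cosMean f t - (1 - t ^ 2 / 2 * m2 f)| ≤ 3 * t ^ 4 * ∫ x, x ^ 4 ∂f := by
  have h2 := integrable_sq (hf.mono_exponent (p := 2) (by norm_num))
  have h := abs_integral_sub_le (integrable_cos f t)
    ((integrable_const (1 : ℝ)).sub (h2.const_mul (t ^ 2 / 2)))
    ((integrable_pow_four hf).const_mul (3 * t ^ 4)) (fun x => by
      refine le_trans (le_of_eq ?_) ((abs_cos_sub_le (t * x)).trans (le_of_eq ?_))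
      · simp only [Pi.sub_apply]; congr 2; ring
      · ring)
  simp only [Pi.sub_apply] at h
  rw [integral_sub (integrable_const _) (h2.const_mul _), integral_const_mul,
    integral_const_mul] at h
  simpa [cosMean, m2] using h

lemma abs_cosMean_sub_one_le (hf : MemLp (fun x : ℝ => x) 2 f) (t : ℝ) :
    |cosMean f t - 1| ≤ t ^ 2 / 2 * m2 f := by
  have h := abs_integral_sub_le (integrable_cos f t) (integrable_const (1 : ℝ))
    ((integrable_sq hf).const_mul (t ^ 2 / 2)) (fun x => by
      rw [abs_sub_comm, abs_of_nonneg (by linarith [Real.cos_le_one (t * x)])]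
      have := Real.one_sub_sq_div_two_le_cos (x := t * x)
      nlinarith)
  rw [integral_const_mul] at h
  simpa [cosMean, m2] using h

lemma abs_sinMean_sub_le (hf : MemLp (fun x : ℝ => x) 4 f) (t : ℝ) :
    |sinMean f t - t * m1 f| ≤ |t| ^ 3 * ∫ x, |x| ^ 3 ∂f := by
  have h1 : Integrable (fun x : ℝ => x) f := hf.integrable (by norm_num)
  have h := abs_integral_sub_le (integrable_sin f t) (h1.const_mul t)
    ((integrable_abs_pow_three hf).const_mul (|t| ^ 3)) (fun x => by
      refine (abs_sin_sub_le (t * x)).trans (le_of_eq ?_)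
      rw [abs_mul, mul_pow])
  rwa [integral_const_mul, integral_const_mul] at h

lemma abs_sinMean_le (hf : Integrable (fun x : ℝ => x) f) (t : ℝ) :
    |sinMean f t| ≤ |t| * ∫ x, |x| ∂f := by
  rw [sinMean, ← integral_const_mul, ← Real.norm_eq_abs]
  refine norm_integral_le_of_norm_le (hf.abs.const_mul _) (.of_forall fun x => ?_)
  rw [← abs_mul]
  exact Real.abs_sin_le_abs

lemma abs_mulSinMean_sub_le (hf : MemLp (fun x : ℝ => x) 4 f) (t : ℝ) :
    |mulSinMean f t - t * m2 f| ≤ |t| ^ 3 * ∫ x, x ^ 4 ∂f := by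
  have h1 : Integrable (fun x : ℝ => x) f := hf.integrable (by norm_num)
  have h2 := integrable_sq (hf.mono_exponent (p := 2) (by norm_num))
  have h := abs_integral_sub_le (integrable_mul_sin f h1 t) (h2.const_mul t)
    ((integrable_pow_four hf).const_mul (|t| ^ 3)) (fun x => by
      rw [show x * Real.sin (t * x) - t * x ^ 2 = x * (Real.sin (t * x) - t * x) by ring, abs_mul]
      refine (mul_le_mul_of_nonneg_left (abs_sin_sub_le (t * x)) (abs_nonneg x)).trans
        (le_of_eq ?_)
      have h4 : x ^ 4 = |x| ^ 4 := by
        rw [← abs_pow]; exact (abs_of_nonneg (by positivity)).symm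
      rw [h4, abs_mul]; ring)
  rwa [integral_const_mul, integral_const_mul] at h

/-- The left side is the squared modulus of a characteristic function. This keeps all bases of large
powers in the unit interval. -/
lemma cosMean_sq_add_sinMean_sq_le (f : Measure ℝ) [IsProbabilityMeasure f] (t : ℝ) :
    cosMean f t ^ 2 + sinMean f t ^ 2 ≤ 1 := by
  have h : ‖cf f t‖ ≤ 1 := by
    refine (norm_integral_le_integral_norm _).trans (le_of_eq ?_)
    have : ∀ x : ℝ, ‖Complex.exp (Complex.I * t * x)‖ = 1 := fun x => by
      rw [Complex.norm_exp]; simp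
    simp [this]
  have h2 : ‖cf f t‖ ^ 2 = cosMean f t ^ 2 + sinMean f t ^ 2 := by
    rw [cf_eq, Complex.sq_norm, Complex.normSq_add_mul_I]
  rw [← h2]
  exact pow_le_one₀ (norm_nonneg _) h

lemma abs_cosMean_le_one (f : Measure ℝ) [IsProbabilityMeasure f] (t : ℝ) :
    |cosMean f t| ≤ 1 := by
  rw [← sq_le_one_iff_abs_le_one]
  nlinarith [cosMean_sq_add_sinMean_sq_le f t, sq_nonneg (sinMean f t)]

lemma abs_cosMean_sq_sub_le_one (f : Measure ℝ) [IsProbabilityMeasure f] (t : ℝ) :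
    |cosMean f t ^ 2 - sinMean f t ^ 2| ≤ 1 := by
  have := cosMean_sq_add_sinMean_sq_le f t
  rw [abs_le]
  constructor <;> nlinarith [sq_nonneg (sinMean f t), sq_nonneg (cosMean f t)]

lemma abs_cosMean_sq_add_le_one (f : Measure ℝ) [IsProbabilityMeasure f] (t : ℝ) :
    |cosMean f t ^ 2 + sinMean f t ^ 2| ≤ 1 := by
  rw [abs_of_nonneg (by positivity)]
  exact cosMean_sq_add_sinMean_sq_le f t

lemma abs_cosMean_sub_exp_le (hf : MemLp (fun x : ℝ => x) 4 f) (t : ℝ) :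
    |cosMean f t - Real.exp (-(t ^ 2 / 2 * m2 f))| ≤
      (3 * (∫ x, x ^ 4 ∂f) + m2 f ^ 2) * t ^ 4 := by
  have h1 := abs_cosMean_sub_le hf t
  have hm := m2_nonneg f
  have h2 := abs_exp_neg_sub_le (y := t ^ 2 / 2 * m2 f) (by positivity)
  rw [abs_sub_comm] at h2
  have h3 := abs_sub_le (cosMean f t) (1 - t ^ 2 / 2 * m2 f) (Real.exp (-(t ^ 2 / 2 * m2 f)))
  have h4 : 0 ≤ t ^ 4 * m2 f ^ 2 := by positivity
  nlinarith

/-- The choice `σ = 1` is the real part of `cf²` and `σ = -1` is `|cf|²`. Both sides agree to second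
order in `t`, and the exponent has the right sign because `𝔼[J]² ≤ 𝔼[J²]`. -/
lemma abs_cosMean_sq_sub_exp_le (hf : MemLp (fun x : ℝ => x) 4 f) (t : ℝ) {σ : ℝ}
    (hσ : |σ| = 1) :
    |cosMean f t ^ 2 - σ * sinMean f t ^ 2 - Real.exp (-(t ^ 2 * (m2 f + σ * m1 f ^ 2)))| ≤
      (6 * (∫ x, x ^ 4 ∂f) + 5 * m2 f ^ 2 + 2 * (∫ x, |x| ^ 3 ∂f) * ∫ x, |x| ∂f) * t ^ 4 := by
  have hf2 := hf.mono_exponent (p := 2) (by norm_num)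
  have hf1 : Integrable (fun x : ℝ => x) f := hf.integrable (by norm_num)
  have hm := m2_nonneg f
  have hv := m1_sq_le_m2 hf2
  set M4 := ∫ x, x ^ 4 ∂f
  set M3 := ∫ x, |x| ^ 3 ∂f with hM3
  set A := ∫ x, |x| ∂f
  set c := cosMean f t
  set q := sinMean f t
  have hM30 : 0 ≤ M3 := integral_nonneg fun x => by positivity
  have hc : |c ^ 2 - (1 - t ^ 2 * m2 f)| ≤ (6 * M4 + m2 f ^ 2) * t ^ 4 := by
    have h1 := abs_cosMean_sub_le hf t
    have h2 := abs_cosMean_sub_one_le hf2 t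
    have h3 : (c - 1) ^ 2 ≤ (t ^ 2 / 2 * m2 f) ^ 2 := sq_le_sq' (abs_le.1 h2).1 (abs_le.1 h2).2
    -- The square `(c - 1)²` is already `O(t⁴)` by the second-moment bound, so only the linear part
    -- needs the fourth moment.
    rw [show c ^ 2 - (1 - t ^ 2 * m2 f) = (c - 1) ^ 2 + 2 * (c - (1 - t ^ 2 / 2 * m2 f)) by ring]
    refine (abs_add_le _ _).trans ?_
    rw [abs_mul, abs_two, abs_of_nonneg (sq_nonneg (c - 1))]
    have h4 : 0 ≤ t ^ 4 * m2 f ^ 2 := by positivity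
    nlinarith
  have hq : |q ^ 2 - t ^ 2 * m1 f ^ 2| ≤ 2 * M3 * A * t ^ 4 := by
    have h1 := abs_sinMean_sub_le hf t
    have h2 := abs_sinMean_le hf1 t
    have h3 : |t * m1 f| ≤ |t| * A := by
      rw [abs_mul]; gcongr; exact abs_integral_le_integral_abs
    rw [show q ^ 2 - t ^ 2 * m1 f ^ 2 = (q - t * m1 f) * (q + t * m1 f) by ring, abs_mul]
    have h4 : |q + t * m1 f| ≤ 2 * (|t| * A) := (abs_add_le _ _).trans (by linarith)
    calc _ ≤ (|t| ^ 3 * M3) * (2 * (|t| * A)) := by gcongr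
      _ = 2 * M3 * A * |t| ^ 4 := by ring
      _ = _ := by rw [← abs_pow, abs_of_nonneg (by positivity : (0:ℝ) ≤ t ^ 4)]
  have hσ' := abs_le.1 hσ.le
  have hy : 0 ≤ t ^ 2 * (m2 f + σ * m1 f ^ 2) := by
    have : 0 ≤ m2 f + σ * m1 f ^ 2 := by nlinarith [sq_nonneg (m1 f)]
    positivity
  have he := abs_exp_neg_sub_le hy
  have hy2 : (t ^ 2 * (m2 f + σ * m1 f ^ 2)) ^ 2 ≤ 4 * m2 f ^ 2 * t ^ 4 := by
    have h1 : t ^ 2 * (m2 f + σ * m1 f ^ 2) ≤ t ^ 2 * (2 * m2 f) := by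
      gcongr; nlinarith [sq_nonneg (m1 f)]
    calc _ ≤ (t ^ 2 * (2 * m2 f)) ^ 2 := pow_le_pow_left₀ hy h1 2
      _ = _ := by ring
  set E := Real.exp (-(t ^ 2 * (m2 f + σ * m1 f ^ 2)))
  rw [show c ^ 2 - σ * q ^ 2 - E = (c ^ 2 - (1 - t ^ 2 * m2 f)) - σ * (q ^ 2 - t ^ 2 * m1 f ^ 2) -
    (E - (1 - t ^ 2 * (m2 f + σ * m1 f ^ 2))) by ring]
  refine (abs_sub _ _).trans ?_
  have h5 := abs_sub (c ^ 2 - (1 - t ^ 2 * m2 f)) (σ * (q ^ 2 - t ^ 2 * m1 f ^ 2))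
  rw [abs_mul, hσ, one_mul] at h5
  linarith

end Moments

/-! ### Uniform expansion of the edge mean at `γ = α/√D` -/

section Uniform

variable {f g : Measure ℝ} [IsProbabilityMeasure f] [IsProbabilityMeasure g]

/-- Replacing the `k`-th power of a number within `K / D²` of `exp(-y)` costs at most `K k / D²`. -/
lemma abs_pow_sub_exp_le {x y K D : ℝ} (hx : |x| ≤ 1) (hy : 0 ≤ y)
    (h : |x - Real.exp (-y)| ≤ K / D ^ 2) (k : ℕ) :
    |x ^ k - Real.exp (-(k * y))| ≤ k * (K / D ^ 2) := by
  have h1 : Real.exp (-(k * y)) = Real.exp (-y) ^ k := by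
    rw [← Real.exp_nat_mul]; congr 1; ring
  have h2 : |Real.exp (-y)| ≤ 1 := by
    rw [abs_of_pos (Real.exp_pos _)]; exact Real.exp_le_one_iff.2 (by linarith)
  rw [h1]
  exact (abs_pow_sub_pow_le_mul hx h2 k).trans (by gcongr)

/-- In `3K + K'`, the power `c ^ (2n)` with `2n ≤ 2D` costs `2K`, the power `P ^ m` costs `K`, and
the field factor `k`, which occurs once, costs `K'`. -/
lemma abs_pow_mul_pow_sub_exp_le {c k P y z K K' : ℝ} {D n m : ℕ} (hD : 1 ≤ D) (hn : n ≤ D)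
    (hm : m ≤ D) (hK : 0 ≤ K) (bc : |c| ≤ 1) (bk : |k| ≤ 1) (bP : |P| ≤ 1) (hy : 0 ≤ y)
    (hz : 0 ≤ z) (ec : |c - Real.exp (-y)| ≤ K / (D : ℝ) ^ 2) (ek : |k - 1| ≤ K' / D)
    (eP : |P - Real.exp (-z)| ≤ K / (D : ℝ) ^ 2) :
    |c ^ (2 * n) * (k * P ^ m) - Real.exp (-(2 * n * y + m * z))| ≤ (3 * K + K') / D := by
  have hD0 : (0 : ℝ) < D := by exact_mod_cast hD
  have bexp : ∀ w : ℝ, 0 ≤ w → |Real.exp (-w)| ≤ 1 := fun w hw => by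
    rw [abs_of_pos (Real.exp_pos _)]; exact Real.exp_le_one_iff.2 (by linarith)
  have e1 : |P ^ m - Real.exp (-(m * z))| ≤ K / D := by
    refine (abs_pow_sub_exp_le bP hz eP m).trans ?_
    calc (m : ℝ) * (K / (D : ℝ) ^ 2) ≤ D * (K / (D : ℝ) ^ 2) := by gcongr
      _ = K / D := by field_simp
  have e2 : |c ^ (2 * n) - Real.exp (-((2 * n : ℕ) * y))| ≤ 2 * (K / D) := by
    refine (abs_pow_sub_exp_le bc hy ec (2 * n)).trans ?_
    have : ((2 * n : ℕ) : ℝ) ≤ 2 * D := by push_cast; gcongr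
    calc ((2 * n : ℕ) : ℝ) * (K / (D : ℝ) ^ 2) ≤ 2 * D * (K / (D : ℝ) ^ 2) := by gcongr
      _ = 2 * (K / D) := by field_simp
  have e3 := abs_mul_sub_mul_le (a' := 1) (b := P ^ m) bk (bexp (m * z) (by positivity))
  rw [one_mul] at e3
  have bc2 : |c ^ (2 * n)| ≤ 1 := by rw [abs_pow]; exact pow_le_one₀ (abs_nonneg _) bc
  have e4 := abs_mul_sub_mul_le (a' := Real.exp (-((2 * n : ℕ) * y))) (b := k * P ^ m) bc2
    (bexp (m * z) (by positivity))
  rw [← Real.exp_add, show -(((2 * n : ℕ) : ℝ) * y) + -(m * z) = -(2 * n * y + m * z) by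
    push_cast; ring] at e4
  have : (3 * K + K') / D = 2 * (K / D) + (K' / D + K / D) := by ring
  linarith

lemma small_angle_bounds (hf : MemLp (fun x : ℝ => x) 4 f) (hg : MemLp (fun x : ℝ => x) 2 g)
    {α : ℝ} (hα : 0 < α) :
    ∃ K : ℝ, 0 ≤ K ∧ ∀ (D : ℕ) (t : ℝ), 1 ≤ D → t = 2 * (α / Real.sqrt D) →
      |cosMean f t - Real.exp (-(2 * α ^ 2 * m2 f / D))| ≤ K / (D : ℝ) ^ 2 ∧
      (∀ σ : ℝ, |σ| = 1 → |cosMean f t ^ 2 - σ * sinMean f t ^ 2 -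
        Real.exp (-(4 * α ^ 2 * (m2 f + σ * m1 f ^ 2) / D))| ≤ K / (D : ℝ) ^ 2) ∧
      |mulSinMean f t - t * m2 f| ≤ K / D ∧ |cosMean g t - 1| ≤ K / D ∧
      sinMean g t ^ 2 ≤ K / D := by
  have hg1 : Integrable (fun x : ℝ => x) g := hg.integrable (by norm_num)
  have hm := m2_nonneg f
  have hmg := m2_nonneg g
  have hM4 : 0 ≤ ∫ x, x ^ 4 ∂f := integral_nonneg fun x => by positivity
  have hM3 : 0 ≤ ∫ x, |x| ^ 3 ∂f := integral_nonneg fun x => by positivity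
  have hA : 0 ≤ ∫ x, |x| ∂f := integral_nonneg fun x => by positivity
  obtain ⟨Kc, hKc⟩ : ∃ K, K = (3 * (∫ x, x ^ 4 ∂f) + m2 f ^ 2) * (16 * α ^ 4) := ⟨_, rfl⟩
  obtain ⟨Kp, hKp⟩ : ∃ K, K = (6 * (∫ x, x ^ 4 ∂f) + 5 * m2 f ^ 2 +
    2 * (∫ x, |x| ^ 3 ∂f) * ∫ x, |x| ∂f) * (16 * α ^ 4) := ⟨_, rfl⟩
  obtain ⟨Ks, hKs⟩ : ∃ K, K = 8 * α ^ 3 * ∫ x, x ^ 4 ∂f := ⟨_, rfl⟩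
  obtain ⟨Kg, hKg⟩ : ∃ K, K = 2 * α ^ 2 * m2 g := ⟨_, rfl⟩
  obtain ⟨Kh, hKh⟩ : ∃ K, K = 4 * α ^ 2 * (∫ x, |x| ∂g) ^ 2 := ⟨_, rfl⟩
  have hKc0 : 0 ≤ Kc := by rw [hKc]; positivity
  have hKp0 : 0 ≤ Kp := by rw [hKp]; positivity
  have hKs0 : 0 ≤ Ks := by rw [hKs]; positivity
  have hKg0 : 0 ≤ Kg := by rw [hKg]; positivity
  have hKh0 : 0 ≤ Kh := by rw [hKh]; positivity
  refine ⟨Kc + Kp + Ks + Kg + Kh, by positivity, fun D t hD ht => ?_⟩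
  have hD1 : (1 : ℝ) ≤ D := by exact_mod_cast hD
  have hD0 : (0 : ℝ) < D := by linarith
  have hr1 : 1 ≤ Real.sqrt D := Real.one_le_sqrt.2 hD1
  have hr0 : 0 < Real.sqrt D := by linarith
  have hrr : Real.sqrt D ^ 2 = D := Real.sq_sqrt hD0.le
  have ht0 : 0 < t := by rw [ht]; positivity
  have ht2 : t ^ 2 = 4 * α ^ 2 / D := by
    rw [ht, mul_pow, div_pow, hrr]; ring
  have ht4 : t ^ 4 = 16 * α ^ 4 / (D : ℝ) ^ 2 := by
    rw [show t ^ 4 = (t ^ 2) ^ 2 by ring, ht2, div_pow]; ring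
  -- The true order is `D^(-3/2)`; `1/D` is all that is needed.
  have ht3 : |t| ^ 3 ≤ 8 * α ^ 3 / D := by
    have h : t ≤ 2 * α := by
      rw [ht]; gcongr; exact div_le_self hα.le hr1
    rw [abs_of_pos ht0, show t ^ 3 = t ^ 2 * t by ring, ht2]
    calc 4 * α ^ 2 / D * t ≤ 4 * α ^ 2 / D * (2 * α) := by gcongr
      _ = 8 * α ^ 3 / D := by ring
  refine ⟨?_, fun σ hσ => ?_, ?_, ?_, ?_⟩
  · have h := abs_cosMean_sub_exp_le hf t
    rw [ht4, ht2] at h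
    rw [show 2 * α ^ 2 * m2 f / D = 4 * α ^ 2 / D / 2 * m2 f by ring]
    refine h.trans ?_
    rw [← mul_div_assoc, ← hKc]
    gcongr; linarith
  · have h := abs_cosMean_sq_sub_exp_le hf t hσ
    rw [ht4, ht2] at h
    rw [show 4 * α ^ 2 * (m2 f + σ * m1 f ^ 2) / D =
      4 * α ^ 2 / D * (m2 f + σ * m1 f ^ 2) by ring]
    refine h.trans ?_
    rw [← mul_div_assoc, ← hKp]
    gcongr; linarith
  · refine (abs_mulSinMean_sub_le hf t).trans ?_
    calc |t| ^ 3 * ∫ x, x ^ 4 ∂f ≤ 8 * α ^ 3 / D * ∫ x, x ^ 4 ∂f := by gcongr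
      _ = Ks / D := by rw [hKs]; ring
      _ ≤ _ := by gcongr; linarith
  · refine (abs_cosMean_sub_one_le hg t).trans ?_
    calc t ^ 2 / 2 * m2 g = Kg / D := by rw [ht2, hKg]; ring
      _ ≤ _ := by gcongr; linarith
  · have h1 := abs_sinMean_le hg1 t
    rw [← sq_abs]
    calc |sinMean g t| ^ 2 ≤ (|t| * ∫ x, |x| ∂g) ^ 2 := by gcongr
      _ = Kh / D := by rw [mul_pow, sq_abs, ht2, hKh]; ring
      _ ≤ _ := by gcongr; linarith

/-- The constant does not depend on how `D` splits into `n + m`, so no regime has to be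
distinguished here. For alignment `σ = ±1` the exponents add up to `4α²𝔼[J²] + σ · 4(m/D)α²𝔼[J]²`,
because `n + m = D`. -/
lemma abs_edgeMean_sub_le (hf : MemLp (fun x : ℝ => x) 4 f) (hg : MemLp (fun x : ℝ => x) 2 g)
    {α : ℝ} (hα : 0 < α) :
    ∃ K : ℝ, 0 ≤ K ∧ ∀ D n m : ℕ, 1 ≤ D → n + m = D → ∀ β : ℝ,
      |edgeMean f g (α / Real.sqrt D) β n m - (C1 f D α β + C2 f α β 1 (m / D))| ≤ K / D := by
  obtain ⟨K, hK, hbounds⟩ := small_angle_bounds hf hg hα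
  have hm2 := m2_nonneg f
  have hv := m1_sq_le_m2 (hf.mono_exponent (p := 2) (by norm_num))
  refine ⟨K + 2 * α * m2 f * (4 * K) + |m1 f| * (6 * K), by positivity, ?_⟩
  intro D n m hD hnm β
  obtain ⟨t, ht⟩ : ∃ t, t = 2 * (α / Real.sqrt D) := ⟨_, rfl⟩
  obtain ⟨ec, eP, eS, ekc, eks⟩ := hbounds D t hD ht
  have hD1 : (1 : ℝ) ≤ D := by exact_mod_cast hD
  have hD0 : (0 : ℝ) < D := by linarith
  have hr1 : 1 ≤ Real.sqrt D := Real.one_le_sqrt.2 hD1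
  have ht0 : 0 < t := by rw [ht]; positivity
  have htα : t ≤ 2 * α := by rw [ht]; gcongr; exact div_le_self hα.le hr1
  have hnmR : (n : ℝ) = D - m := by rw [← hnm]; push_cast; ring
  have bc := abs_cosMean_le_one f t
  have bkc := abs_cosMean_le_one g t
  have hy : 0 ≤ 2 * α ^ 2 * m2 f / D := by positivity
  have h1 : |mulSinMean f t * (cosMean g t * cosMean f t ^ D) -
      t * m2 f * Real.exp (-2 * α ^ 2 * m2 f)| ≤ (K + 2 * α * m2 f * (4 * K)) / D := by
    -- The single-flip term is the case `n = 0`, `m = D`, with the base `P` equal to the cosine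
    -- mean.
    have e := abs_pow_mul_pow_sub_exp_le (n := 0) (m := D) hD (Nat.zero_le _) le_rfl hK bc bkc bc
      hy hy ec ekc ec
    rw [mul_zero, pow_zero, one_mul, show -(2 * ((0 : ℕ) : ℝ) * (2 * α ^ 2 * m2 f / D) +
      D * (2 * α ^ 2 * m2 f / D)) = -2 * α ^ 2 * m2 f by push_cast; field_simp; ring] at e
    have b2 : |cosMean g t * cosMean f t ^ D| ≤ 1 := by
      rw [abs_mul, abs_pow]
      exact mul_le_one₀ bkc (by positivity) (pow_le_one₀ (abs_nonneg _) bc)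
    rw [show ∀ S p s E : ℝ, S * p - s * E = (S - s) * p + s * (p - E) from
      fun S p s E => by ring]
    refine (abs_add_le _ _).trans ?_
    rw [abs_mul, abs_mul (t * m2 f), abs_of_nonneg (by positivity : 0 ≤ t * m2 f)]
    calc _ ≤ K / D * 1 + 2 * α * m2 f * ((3 * K + K) / D) := by gcongr
      _ = _ := by ring
  have h2 : ∀ σ : ℝ, σ = 1 ∨ σ = -1 →
      |cosMean f t ^ (2 * n) * ((cosMean g t ^ 2 - σ * sinMean g t ^ 2) *
        (cosMean f t ^ 2 - σ * sinMean f t ^ 2) ^ m) - Real.exp (-4 * 1 * α ^ 2 * m2 f) *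
          Real.exp (-(σ * (4 * (m / D) * α ^ 2 * m1 f ^ 2)))| ≤ 6 * K / D := by
    intro σ hσ
    have hσ1 : |σ| = 1 := by rcases hσ with rfl | rfl <;> simp
    have bP : |cosMean f t ^ 2 - σ * sinMean f t ^ 2| ≤ 1 := by
      rcases hσ with rfl | rfl
      · simpa using abs_cosMean_sq_sub_le_one f t
      · simpa using abs_cosMean_sq_add_le_one f t
    have bk : |cosMean g t ^ 2 - σ * sinMean g t ^ 2| ≤ 1 := by
      rcases hσ with rfl | rfl
      · simpa using abs_cosMean_sq_sub_le_one g t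
      · simpa using abs_cosMean_sq_add_le_one g t
    have hz : 0 ≤ 4 * α ^ 2 * (m2 f + σ * m1 f ^ 2) / D := by
      have : 0 ≤ m2 f + σ * m1 f ^ 2 := by
        rcases hσ with rfl | rfl <;> nlinarith [sq_nonneg (m1 f)]
      positivity
    have ek : |cosMean g t ^ 2 - σ * sinMean g t ^ 2 - 1| ≤ 3 * K / D := by
      rw [show cosMean g t ^ 2 - σ * sinMean g t ^ 2 - 1 =
        (cosMean g t - 1) * (cosMean g t + 1) - σ * sinMean g t ^ 2 by ring]
      refine (abs_sub _ _).trans ?_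
      rw [abs_mul, abs_mul, hσ1, one_mul, abs_of_nonneg (sq_nonneg (sinMean g t))]
      have b3 : |cosMean g t + 1| ≤ 2 := (abs_add_le _ _).trans (by rw [abs_one]; linarith)
      calc _ ≤ K / D * 2 + K / D := by gcongr
        _ = _ := by ring
    have e := abs_pow_mul_pow_sub_exp_le (n := n) (m := m) hD (by omega) (by omega) hK bc bk bP
      hy hz ec ek (eP σ hσ1)
    rw [← Real.exp_add, show -4 * 1 * α ^ 2 * m2 f + -(σ * (4 * (m / D) * α ^ 2 * m1 f ^ 2)) =
      -(2 * n * (2 * α ^ 2 * m2 f / D) + m * (4 * α ^ 2 * (m2 f + σ * m1 f ^ 2) / D)) by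
        rw [hnmR]; field_simp; ring]
    refine e.trans (le_of_eq ?_)
    ring
  have h2p := h2 1 (Or.inl rfl)
  have h2m := h2 (-1) (Or.inr rfl)
  -- An exact identity: `sinh` is half the `σ = -1` exponential minus half the `σ = 1` one.
  have hmain : edgeMean f g (α / Real.sqrt D) β n m - (C1 f D α β + C2 f α β 1 (m / D)) =
      Real.sin (4 * β) * (mulSinMean f t * (cosMean g t * cosMean f t ^ D) -
        t * m2 f * Real.exp (-2 * α ^ 2 * m2 f)) +
      Real.sin (2 * β) ^ 2 * (m1 f * ((1 / 2) *
        ((cosMean f t ^ (2 * n) * ((cosMean g t ^ 2 - -1 * sinMean g t ^ 2) *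
        (cosMean f t ^ 2 - -1 * sinMean f t ^ 2) ^ m) - Real.exp (-4 * 1 * α ^ 2 * m2 f) *
          Real.exp (-(-1 * (4 * (m / D) * α ^ 2 * m1 f ^ 2)))) -
        (cosMean f t ^ (2 * n) * ((cosMean g t ^ 2 - 1 * sinMean g t ^ 2) *
        (cosMean f t ^ 2 - 1 * sinMean f t ^ 2) ^ m) - Real.exp (-4 * 1 * α ^ 2 * m2 f) *
          Real.exp (-(1 * (4 * (m / D) * α ^ 2 * m1 f ^ 2))))))) := by
    rw [edgeMean, C1, C2, hnm, Real.sinh_eq, ← ht,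
      show t * m2 f * Real.exp (-2 * α ^ 2 * m2 f) =
        2 * α * m2 f * Real.exp (-2 * α ^ 2 * m2 f) * (1 / Real.sqrt D) by rw [ht]; ring]
    simp only [neg_mul, neg_neg, one_mul, sub_neg_eq_add]
    ring
  rw [hmain]
  refine (abs_add_le _ _).trans ?_
  rw [abs_mul, abs_mul (Real.sin (2 * β) ^ 2), abs_mul (m1 f), abs_mul (1 / 2 : ℝ)]
  have s4 : |Real.sin (4 * β)| ≤ 1 := Real.abs_sin_le_one _
  have s2 : |Real.sin (2 * β) ^ 2| ≤ 1 := by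
    rw [abs_pow]; exact pow_le_one₀ (abs_nonneg _) (Real.abs_sin_le_one _)
  have h3 := (abs_sub _ _).trans (add_le_add h2m h2p)
  calc _ ≤ 1 * ((K + 2 * α * m2 f * (4 * K)) / D) +
        1 * (|m1 f| * (|1 / 2| * (6 * K / D + 6 * K / D))) := by gcongr
    _ = _ := by rw [abs_of_pos (by norm_num : (0:ℝ) < 1 / 2)]; ring

end Uniform

/-! ### The expansions -/

section Expansions

lemma abs_exp_neg_sub_one_le {y : ℝ} (hy : 0 ≤ y) : |Real.exp (-y) - 1| ≤ y := by
  rw [abs_sub_comm, abs_of_nonneg (by linarith [Real.exp_le_one_iff.2 (neg_nonpos.2 hy)])]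
  linarith [Real.add_one_le_exp (-y)]

lemma exp_sub_one_le {x : ℝ} : Real.exp x - 1 ≤ x * Real.exp x := by
  have h1 := Real.add_one_le_exp (-x)
  have h2 : Real.exp (-x) * Real.exp x = 1 := by rw [← Real.exp_add]; simp
  nlinarith [Real.exp_pos x]

/-- Write `sinh x` as `exp(-x)(exp(2x) - 1)/2`. -/
lemma sinh_le_mul_exp {x : ℝ} : Real.sinh x ≤ x * Real.exp x := by
  have h := exp_sub_one_le (x := 2 * x)
  rw [Real.sinh_eq]
  have h4 := Real.exp_pos (-x)
  have h5 : Real.exp x = Real.exp (-x) * Real.exp (2 * x) := by rw [← Real.exp_add]; ring_nf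
  have h6 := mul_le_mul_of_nonneg_left h h4.le
  rw [mul_sub, ← h5, mul_one,
    show Real.exp (-x) * (2 * x * Real.exp (2 * x)) =
      2 * x * (Real.exp (-x) * Real.exp (2 * x)) by ring, ← h5] at h6
  linarith

lemma abs_sinh_sub_le {x : ℝ} (hx : 0 ≤ x) : |Real.sinh x - x| ≤ x ^ 2 * Real.exp x := by
  rw [abs_of_nonneg (by linarith [Real.self_le_sinh_iff.2 hx])]
  have h1 := sinh_le_mul_exp (x := x)
  have h2 := exp_sub_one_le (x := x)
  nlinarith

variable (f : Measure ℝ)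

lemma abs_C1_le {α : ℝ} (hα : 0 < α) (D : ℕ) (β : ℝ) :
    |C1 f D α β| ≤ 2 * α * m2 f * (D : ℝ) ^ (-1 / 2 : ℝ) := by
  have hm := m2_nonneg f
  have h1 : |Real.sin (4 * β)| ≤ 1 := Real.abs_sin_le_one _
  have h2 : Real.exp (-2 * α ^ 2 * m2 f) ≤ 1 := by
    rw [Real.exp_le_one_iff]
    have : 0 ≤ α ^ 2 * m2 f := by positivity
    linarith
  have h3 : 1 / Real.sqrt D = (D : ℝ) ^ (-1 / 2 : ℝ) := by
    rw [Real.sqrt_eq_rpow, neg_div, Real.rpow_neg (by positivity), one_div]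
  rw [C1, h3, abs_mul, abs_mul, abs_mul, abs_mul, abs_of_pos (Real.exp_pos _), abs_of_nonneg hm,
    abs_of_pos (by positivity : 0 < 2 * α),
    abs_of_nonneg (by positivity : (0 : ℝ) ≤ (D : ℝ) ^ (-1 / 2 : ℝ))]
  have h4 : |Real.sin (4 * β)| * Real.exp (-2 * α ^ 2 * m2 f) ≤ 1 :=
    mul_le_one₀ h1 (Real.exp_pos _).le h2
  calc _ = 2 * α * m2 f * (|Real.sin (4 * β)| * Real.exp (-2 * α ^ 2 * m2 f)) *
        (D : ℝ) ^ (-1 / 2 : ℝ) := by ring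
    _ ≤ 2 * α * m2 f * 1 * (D : ℝ) ^ (-1 / 2 : ℝ) := by gcongr
    _ = _ := by ring

lemma abs_sin_sq_mul_le (β x : ℝ) : |Real.sin (2 * β) ^ 2 * m1 f * x| ≤ |m1 f| * |x| := by
  rw [abs_mul, abs_mul, abs_pow]
  have : |Real.sin (2 * β)| ^ 2 ≤ 1 := pow_le_one₀ (abs_nonneg _) (Real.abs_sin_le_one _)
  gcongr
  exact mul_le_of_le_one_left (abs_nonneg _) this

/-- A bound for `sinh (4 t α² 𝔼[J]²) / t`, uniform in `0 < t ≤ 1`. -/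
def sinhBound (f : Measure ℝ) (α : ℝ) : ℝ := 4 * α ^ 2 * m1 f ^ 2 * Real.exp (4 * α ^ 2 * m1 f ^ 2)

lemma sinhBound_nonneg (α : ℝ) : 0 ≤ sinhBound f α := by unfold sinhBound; positivity

lemma abs_sinh_le {α t : ℝ} (h0 : 0 ≤ t) (h1 : t ≤ 1) :
    |Real.sinh (4 * t * α ^ 2 * m1 f ^ 2)| ≤ t * sinhBound f α := by
  have hx : 0 ≤ 4 * t * α ^ 2 * m1 f ^ 2 := by positivity
  rw [abs_of_nonneg (Real.sinh_nonneg_iff.2 hx)]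
  refine sinh_le_mul_exp.trans ?_
  have : 4 * t * α ^ 2 * m1 f ^ 2 ≤ 4 * α ^ 2 * m1 f ^ 2 := by
    have : 0 ≤ α ^ 2 * m1 f ^ 2 := by positivity
    nlinarith
  calc _ ≤ 4 * t * α ^ 2 * m1 f ^ 2 * Real.exp (4 * α ^ 2 * m1 f ^ 2) := by gcongr
    _ = _ := by rw [sinhBound]; ring

/-- Splitting the Gaussian by `s + t = 1` isolates the factor that tends to `1`: the `s` factor when
triangles dominate, the `t` factor when they are rare. -/
lemma C2_one_eq {α β t s : ℝ} (hst : s + t = 1) : C2 f α β 1 t = Real.sin (2 * β) ^ 2 * m1 f *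
    (Real.exp (-(4 * t * α ^ 2 * m2 f)) * Real.exp (-(4 * s * α ^ 2 * m2 f)) *
      Real.sinh (4 * t * α ^ 2 * m1 f ^ 2)) := by
  rw [C2, ← Real.exp_add, mul_assoc _ (Real.exp _)]
  congr 3
  rw [← hst]; ring

lemma C2_self_eq (α β t : ℝ) : C2 f α β t t = Real.sin (2 * β) ^ 2 * m1 f *
    (Real.exp (-(4 * t * α ^ 2 * m2 f)) * Real.sinh (4 * t * α ^ 2 * m1 f ^ 2)) := by
  rw [C2, mul_assoc _ (Real.exp _)]
  congr 3
  ring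

lemma exp_neg_le_one {y : ℝ} (hy : 0 ≤ y) : Real.exp (-y) ≤ 1 :=
  Real.exp_le_one_iff.2 (by linarith)

lemma abs_C2_one_le (α β : ℝ) {t s : ℝ} (ht : 0 ≤ t) (hs : 0 ≤ s) (hst : s + t = 1) :
    |C2 f α β 1 t| ≤ |m1 f| * sinhBound f α * t := by
  have hm := m2_nonneg f
  rw [C2_one_eq f hst]
  refine (abs_sin_sq_mul_le f β _).trans ?_
  rw [abs_mul, abs_mul, abs_of_pos (Real.exp_pos _), abs_of_pos (Real.exp_pos _)]
  have h1 := exp_neg_le_one (y := 4 * t * α ^ 2 * m2 f) (by positivity)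
  have h2 := exp_neg_le_one (y := 4 * s * α ^ 2 * m2 f) (by positivity)
  have h3 := abs_sinh_le f (α := α) ht (by linarith)
  have h4 : 0 ≤ t * sinhBound f α := mul_nonneg ht (sinhBound_nonneg f α)
  calc _ ≤ |m1 f| * (1 * 1 * (t * sinhBound f α)) := by gcongr
    _ = _ := by ring

lemma abs_C2_one_sub_C2_self_le (α β : ℝ) {t s : ℝ} (ht : 0 ≤ t) (hs : 0 ≤ s)
    (hst : s + t = 1) :
    |C2 f α β 1 t - C2 f α β t t| ≤ |m1 f| * sinhBound f α * (4 * α ^ 2 * m2 f) * s := by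
  have hm := m2_nonneg f
  rw [C2_one_eq f hst, C2_self_eq, ← mul_sub]
  refine (abs_sin_sq_mul_le f β _).trans ?_
  rw [show ∀ e e' S : ℝ, e * e' * S - e * S = e * S * (e' - 1) from fun e e' S => by ring,
    abs_mul, abs_mul, abs_of_pos (Real.exp_pos _)]
  have h1 := exp_neg_le_one (y := 4 * t * α ^ 2 * m2 f) (by positivity)
  have h2 := abs_exp_neg_sub_one_le (y := 4 * s * α ^ 2 * m2 f) (by positivity)
  have h3 : |Real.sinh (4 * t * α ^ 2 * m1 f ^ 2)| ≤ sinhBound f α :=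
    (abs_sinh_le f (α := α) ht (by linarith)).trans
      (mul_le_of_le_one_left (sinhBound_nonneg f α) (by linarith))
  have h4 := sinhBound_nonneg f α
  calc _ ≤ |m1 f| * (1 * sinhBound f α * (4 * s * α ^ 2 * m2 f)) := by gcongr
    _ = _ := by ring

/-- The `s` factor is kept to first order, hence the error `s²`. -/
lemma abs_C2_one_sub_C2_self_mul_le (α β : ℝ) {t s : ℝ} (ht : 0 ≤ t) (hs : 0 ≤ s)
    (hst : s + t = 1) :
    |C2 f α β 1 t - C2 f α β t t * (1 - 4 * s * α ^ 2 * m2 f)| ≤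
      |m1 f| * sinhBound f α * (4 * α ^ 2 * m2 f) ^ 2 * s ^ 2 := by
  have hm := m2_nonneg f
  rw [C2_one_eq f hst, C2_self_eq, mul_assoc (Real.sin (2 * β) ^ 2 * m1 f), ← mul_sub]
  refine (abs_sin_sq_mul_le f β _).trans ?_
  rw [show ∀ e e' S w : ℝ, e * e' * S - e * S * w = e * S * (e' - w) from
    fun e e' S w => by ring, abs_mul, abs_mul, abs_of_pos (Real.exp_pos _)]
  have h1 := exp_neg_le_one (y := 4 * t * α ^ 2 * m2 f) (by positivity)
  have h2 := abs_exp_neg_sub_le (y := 4 * s * α ^ 2 * m2 f) (by positivity)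
  have h3 : |Real.sinh (4 * t * α ^ 2 * m1 f ^ 2)| ≤ sinhBound f α :=
    (abs_sinh_le f (α := α) ht (by linarith)).trans
      (mul_le_of_le_one_left (sinhBound_nonneg f α) (by linarith))
  have h4 := sinhBound_nonneg f α
  calc _ ≤ |m1 f| * (1 * sinhBound f α * (4 * s * α ^ 2 * m2 f) ^ 2) := by gcongr
    _ = _ := by ring

/-- The `sinh` is already of order `t`, so replacing the `t` factor by `1` costs `t²`, as does
replacing `sinh` by its argument. -/
lemma abs_C2_one_sub_linear_le (α β : ℝ) {t s : ℝ} (ht : 0 ≤ t) (hs : 0 ≤ s) (hst : s + t = 1) :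
    |C2 f α β 1 t - 4 * t * α ^ 2 * Real.sin (2 * β) ^ 2 * m1 f ^ 3 *
      Real.exp (-4 * s * α ^ 2 * m2 f)| ≤
      |m1 f| * (4 * α ^ 2 * m2 f * sinhBound f α + 4 * α ^ 2 * m1 f ^ 2 * sinhBound f α) *
        t ^ 2 := by
  have hm := m2_nonneg f
  have h0 : -4 * s * α ^ 2 * m2 f = -(4 * s * α ^ 2 * m2 f) := by ring
  rw [C2_one_eq f hst, h0, show ∀ e e' S x w k : ℝ, w * k * (e * e' * S) - x * w * k ^ 3 * e' =
    w * k * ((e - 1) * S * e' + (S - x * k ^ 2) * e') from fun _ _ _ _ _ _ => by ring]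
  refine (abs_sin_sq_mul_le f β _).trans ?_
  have h1 := exp_neg_le_one (y := 4 * s * α ^ 2 * m2 f) (by positivity)
  have h2 := abs_exp_neg_sub_one_le (y := 4 * t * α ^ 2 * m2 f) (by positivity)
  have h3 := abs_sinh_le f (α := α) ht (by linarith)
  have h4 := sinhBound_nonneg f α
  have h5 : |Real.sinh (4 * t * α ^ 2 * m1 f ^ 2) - 4 * t * α ^ 2 * m1 f ^ 2| ≤
      4 * α ^ 2 * m1 f ^ 2 * sinhBound f α * t ^ 2 := by
    refine (abs_sinh_sub_le (by positivity)).trans ?_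
    have : 4 * t * α ^ 2 * m1 f ^ 2 ≤ 4 * α ^ 2 * m1 f ^ 2 := by
      have : 0 ≤ α ^ 2 * m1 f ^ 2 := by positivity
      nlinarith
    calc _ ≤ (4 * t * α ^ 2 * m1 f ^ 2) ^ 2 * Real.exp (4 * α ^ 2 * m1 f ^ 2) := by gcongr
      _ = _ := by rw [sinhBound]; ring
  rw [mul_assoc |m1 f|]
  gcongr
  refine (abs_add_le _ _).trans ?_
  rw [abs_mul, abs_mul, abs_mul, abs_of_pos (Real.exp_pos (-(4 * s * α ^ 2 * m2 f)))]
  calc _ ≤ 4 * t * α ^ 2 * m2 f * (t * sinhBound f α) * 1 +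
        4 * α ^ 2 * m1 f ^ 2 * sinhBound f α * t ^ 2 * 1 := by gcongr
    _ = _ := by ring

variable {f} {g : Measure ℝ} [IsProbabilityMeasure f] [IsProbabilityMeasure g]

lemma exists_abs_scaledExpectedCost_sub_le (hf : MemLp (fun x : ℝ => x) 4 f)
    (hg : MemLp (fun x : ℝ => x) 2 g) {α : ℝ} (hα : 0 < α) :
    ∃ K : ℝ, 0 ≤ K ∧ ∀ (D : ℕ) (a b lam μ : ℝ), 1 ≤ D →
      ∀ (V : Type*) [Fintype V] [DecidableEq V] [Nonempty V] (G : SimpleGraph V)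
        [DecidableRel G.Adj], HasCounts G D a b lam μ →
        a * (D : ℝ) ^ (lam - 1) + b * (D : ℝ) ^ (μ - 1) = 1 ∧ ∀ β : ℝ,
          |scaledExpectedCost G f g (α / Real.sqrt D) β -
            (C1 f D α β + C2 f α β 1 (b * (D : ℝ) ^ (μ - 1)))| ≤ K * (D : ℝ) ^ (-1 : ℝ) := by
  have hf1 : Integrable (fun x : ℝ => x) f := hf.integrable (by norm_num)
  have hg1 : Integrable (fun x : ℝ => x) g := hg.integrable (by norm_num)
  obtain ⟨K, hK, h⟩ := abs_edgeMean_sub_le hf hg hα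
  have hB : 0 ≤ ∫ x, |x| ∂g := integral_nonneg fun x => abs_nonneg x
  refine ⟨4 * (∫ x, |x| ∂g) + K, by positivity, ?_⟩
  intro D a b lam μ hD V _ _ _ G _ hG
  obtain ⟨n, m, hn, hm, hnm, hle⟩ := scaledExpectedCost_sub_edgeMean_le G f g hf1 hg1 hG
  have hD0 : (0 : ℝ) < D := by exact_mod_cast hD
  have hs : a * (D : ℝ) ^ (lam - 1) = n / D := by
    rw [hn, Real.rpow_sub_one hD0.ne']; ring
  have ht : b * (D : ℝ) ^ (μ - 1) = m / D := by
    rw [hm, Real.rpow_sub_one hD0.ne']; ring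
  refine ⟨?_, fun β => ?_⟩
  · rw [hs, ht, ← add_div, div_eq_one_iff_eq hD0.ne']
    exact_mod_cast hnm
  · rw [ht, Real.rpow_neg_one, ← div_eq_mul_inv]
    refine (abs_sub_le _ (edgeMean f g (α / Real.sqrt D) β n m) _).trans ?_
    have h1 := hle (α / Real.sqrt D) β
    have h2 := h D n m hD hnm β
    have h3 : 4 * (∫ x, |x| ∂g) / ((D : ℝ) + 1) ≤ 4 * (∫ x, |x| ∂g) / D := by gcongr; linarith
    rw [add_div]
    linarith

/-- Each regime becomes a deterministic inequality for `C2` under `s + t = 1`; the `O(1/D)` from the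
graph is absorbed because `-1 ≤ r`. -/
lemma expansion_of_le (hf : MemLp (fun x : ℝ => x) 4 f) (hg : MemLp (fun x : ℝ => x) 2 g)
    {α : ℝ} (hα : 0 < α) {lam μ r : ℝ} {P : ℝ → ℝ → Prop} {main : ℕ → ℝ → ℝ → ℝ → ℝ}
    (hr : -1 ≤ r)
    (h : ∀ A : ℝ, 0 ≤ A → ∃ K : ℝ, ∀ D : ℕ, 1 ≤ D → ∀ a b : ℝ, 0 ≤ a → a ≤ A → 0 ≤ b → b ≤ A →
      P a b → a * (D : ℝ) ^ (lam - 1) + b * (D : ℝ) ^ (μ - 1) = 1 → ∀ β : ℝ,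
      |C1 f D α β + C2 f α β 1 (b * (D : ℝ) ^ (μ - 1)) - main D a b β| ≤ K * (D : ℝ) ^ r) :
    Expansion f g α lam μ P main r := by
  intro A
  obtain ⟨K, hK, h1⟩ := exists_abs_scaledExpectedCost_sub_le hf hg hα
  -- The bound `A` in `Expansion` may be negative, hence `|A|`.
  obtain ⟨K', h2⟩ := h |A| (abs_nonneg A)
  refine ⟨K + K', 1, fun D hD a b ha haA hb hbA hP V _ _ _ G _ hG β => ⟨?_, ?_⟩⟩
  · exact integrable_qaoaCost G f g (hf.integrable (by norm_num)) (hg.integrable (by norm_num)) _ _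
  · obtain ⟨hst, h3⟩ := h1 D a b lam μ hD V G hG
    have h4 := h2 D hD a b ha (haA.trans (le_abs_self A)) hb (hbA.trans (le_abs_self A)) hP hst β
    have h5 := h3 β
    have hD1 : (1 : ℝ) ≤ D := by exact_mod_cast hD
    have h6 : (D : ℝ) ^ (-1 : ℝ) ≤ (D : ℝ) ^ r := Real.rpow_le_rpow_of_exponent_le hD1 hr
    have h7 : K * (D : ℝ) ^ (-1 : ℝ) ≤ K * (D : ℝ) ^ r := by gcongr
    refine (abs_sub_le _ (C1 f D α β + C2 f α β 1 (b * (D : ℝ) ^ (μ - 1))) _).trans ?_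
    linarith

lemma rpow_sub_one_sq {D : ℕ} (hD : 1 ≤ D) (r : ℝ) :
    ((D : ℝ) ^ (r - 1)) ^ 2 = (D : ℝ) ^ (2 * r - 2) := by
  have hD0 : (0 : ℝ) ≤ D := by positivity
  rw [← Real.rpow_natCast, ← Real.rpow_mul hD0]
  congr 1; push_cast; ring

lemma one_div_sqrt_eq (D : ℕ) : 1 / Real.sqrt D = (D : ℝ) ^ ((1 / 2 : ℝ) - 1) := by
  rw [Real.sqrt_eq_rpow, one_div, ← Real.rpow_neg (by positivity)]
  norm_num

lemma rpow_le_max_left {D : ℕ} (hD : 1 ≤ D) (r s : ℝ) : (D : ℝ) ^ r ≤ (D : ℝ) ^ max r s :=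
  Real.rpow_le_rpow_of_exponent_le (by exact_mod_cast hD) (le_max_left _ _)

lemma rpow_le_max_right {D : ℕ} (hD : 1 ≤ D) (r s : ℝ) : (D : ℝ) ^ s ≤ (D : ℝ) ^ max r s :=
  Real.rpow_le_rpow_of_exponent_le (by exact_mod_cast hD) (le_max_right _ _)

/-- With `t = 0` the `sinh` vanishes, so the uniform expansion is already the claim. The next two
cases are likewise exact, which is why their extra constant is `0`. -/
lemma expansion_no_triangles (hf : MemLp (fun x : ℝ => x) 4 f) (hg : MemLp (fun x : ℝ => x) 2 g)
    {α : ℝ} (hα : 0 < α) (μ : ℝ) :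
    Expansion f g α 1 μ (fun a b => b = 0 ∧ a = 1)
      (fun D _ _ β => C1 f D α β) (-1) := by
  refine expansion_of_le hf hg hα le_rfl fun A hA => ⟨0, ?_⟩
  rintro D hD a b ha haA hb hbA ⟨rfl, rfl⟩ hst β
  simp [C2]

lemma expansion_all_triangles (hf : MemLp (fun x : ℝ => x) 4 f) (hg : MemLp (fun x : ℝ => x) 2 g)
    {α : ℝ} (hα : 0 < α) (lam : ℝ) :
    Expansion f g α lam 1 (fun a b => a = 0 ∧ b = 1)
      (fun D _ _ β => C1 f D α β + C2 f α β 1 1) (-1) := by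
  refine expansion_of_le hf hg hα le_rfl fun A hA => ⟨0, ?_⟩
  rintro D hD a b ha haA hb hbA ⟨rfl, rfl⟩ hst β
  simp

lemma expansion_linear_linear (hf : MemLp (fun x : ℝ => x) 4 f) (hg : MemLp (fun x : ℝ => x) 2 g)
    {α : ℝ} (hα : 0 < α) :
    Expansion f g α 1 1 (fun a b => 0 < a ∧ 0 < b)
      (fun D _ b β => C1 f D α β + C2 f α β 1 b) (-1) := by
  refine expansion_of_le hf hg hα le_rfl fun A hA => ⟨0, ?_⟩
  intro D hD a b ha haA hb hbA _ hst β
  simp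

lemma expansion_linear_triangles_of_lt (hf : MemLp (fun x : ℝ => x) 4 f) (hg : MemLp (fun x : ℝ => x) 2 g)
    {α : ℝ} (hα : 0 < α) {lam : ℝ} (hlam : 0 ≤ lam) :
    Expansion f g α lam 1 (fun a b => 0 < a ∧ 0 < b)
      (fun D _ b β => C1 f D α β + C2 f α β b b) (lam - 1) := by
  refine expansion_of_le hf hg hα (by linarith) fun A hA => ⟨|m1 f| * sinhBound f α * (4 * α ^ 2 * m2 f) * A, ?_⟩
  intro D hD a b ha haA hb hbA _ hst β
  have hs : 0 ≤ a * (D : ℝ) ^ (lam - 1) := by positivity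
  rw [sub_self, Real.rpow_zero, mul_one] at hst ⊢
  rw [add_sub_add_left_eq_sub]
  refine (abs_C2_one_sub_C2_self_le f α β hb hs hst).trans ?_
  have hm := m2_nonneg f
  have h4 := sinhBound_nonneg f α
  rw [mul_assoc _ A]
  gcongr

lemma abs_C2_sub_correction_le (α β : ℝ) {A a b lam : ℝ} {D : ℕ} (hD : 1 ≤ D) (ha : 0 ≤ a)
    (haA : a ≤ A) (hb : 0 ≤ b) (hst : a * (D : ℝ) ^ (lam - 1) + b = 1) :
    |C2 f α β 1 b - C2 f α β b b * (1 - 4 * a * α ^ 2 * m2 f * (D : ℝ) ^ (lam - 1))| ≤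
      |m1 f| * sinhBound f α * (4 * α ^ 2 * m2 f) ^ 2 * A ^ 2 * (D : ℝ) ^ (2 * lam - 2) := by
  have hs : 0 ≤ a * (D : ℝ) ^ (lam - 1) := by positivity
  rw [show 4 * a * α ^ 2 * m2 f * (D : ℝ) ^ (lam - 1) =
    4 * (a * (D : ℝ) ^ (lam - 1)) * α ^ 2 * m2 f by ring]
  refine (abs_C2_one_sub_C2_self_mul_le f α β hb hs hst).trans ?_
  have h4 := sinhBound_nonneg f α
  rw [mul_pow _ ((D : ℝ) ^ _), rpow_sub_one_sq hD, mul_assoc _ (A ^ 2)]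
  gcongr

lemma expansion_linear_triangles_half (hf : MemLp (fun x : ℝ => x) 4 f) (hg : MemLp (fun x : ℝ => x) 2 g)
    {α : ℝ} (hα : 0 < α) :
    Expansion f g α (1 / 2) 1 (fun a b => 0 < a ∧ 0 < b)
      (fun D a b β => C1 f D α β +
        C2 f α β b b * (1 - 4 * a * α ^ 2 * m2 f * (1 / Real.sqrt D))) (max (2 * (1 / 2) - 2) (-1)) := by
  refine expansion_of_le hf hg hα (le_max_right _ _) fun A hA => ⟨|m1 f| * sinhBound f α * (4 * α ^ 2 * m2 f) ^ 2 * A ^ 2, ?_⟩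
  intro D hD a b ha haA hb hbA _ hst β
  rw [sub_self, Real.rpow_zero, mul_one] at hst ⊢
  rw [add_sub_add_left_eq_sub, one_div_sqrt_eq]
  refine (abs_C2_sub_correction_le α β hD ha haA hb hst).trans ?_
  have h4 := sinhBound_nonneg f α
  exact mul_le_mul_of_nonneg_left (rpow_le_max_left hD _ _) (by positivity)

/-- `C1` has order `D^(-1/2)` and goes into the error term. -/
lemma expansion_linear_triangles_of_gt (hf : MemLp (fun x : ℝ => x) 4 f) (hg : MemLp (fun x : ℝ => x) 2 g)
    {α : ℝ} (hα : 0 < α) (lam : ℝ) :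
    Expansion f g α lam 1 (fun a b => 0 < a ∧ 0 < b)
      (fun D a b β => C2 f α β b b * (1 - 4 * a * α ^ 2 * m2 f * (D : ℝ) ^ (lam - 1))) (max (-1 / 2) (2 * lam - 2)) := by
  refine expansion_of_le hf hg hα (le_max_of_le_left (by norm_num)) fun A hA => ⟨2 * α * m2 f + |m1 f| * sinhBound f α * (4 * α ^ 2 * m2 f) ^ 2 * A ^ 2, ?_⟩
  intro D hD a b ha haA hb hbA _ hst β
  rw [sub_self, Real.rpow_zero, mul_one] at hst ⊢
  rw [add_sub_assoc]
  refine (abs_add_le _ _).trans ?_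
  have hm := m2_nonneg f
  have h4 := sinhBound_nonneg f α
  rw [add_mul]
  exact add_le_add ((abs_C1_le f hα D β).trans
      (mul_le_mul_of_nonneg_left (rpow_le_max_left hD _ _) (by positivity)))
    ((abs_C2_sub_correction_le α β hD ha haA hb hst).trans
      (mul_le_mul_of_nonneg_left (rpow_le_max_right hD _ _) (by positivity)))

lemma abs_C2_sub_C3_le (α β : ℝ) {A a b μ : ℝ} {D : ℕ} (hD : 1 ≤ D) (ha : 0 ≤ a)
    (hb : 0 ≤ b) (hbA : b ≤ A) (hst : a + b * (D : ℝ) ^ (μ - 1) = 1) :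
    |C2 f α β 1 (b * (D : ℝ) ^ (μ - 1)) - C3 f D a b μ α β| ≤
      |m1 f| * (4 * α ^ 2 * m2 f * sinhBound f α + 4 * α ^ 2 * m1 f ^ 2 * sinhBound f α) * A ^ 2 *
        (D : ℝ) ^ (2 * μ - 2) := by
  have ht : 0 ≤ b * (D : ℝ) ^ (μ - 1) := by positivity
  rw [show C3 f D a b μ α β = 4 * (b * (D : ℝ) ^ (μ - 1)) * α ^ 2 * Real.sin (2 * β) ^ 2 *
    m1 f ^ 3 * Real.exp (-4 * a * α ^ 2 * m2 f) by rw [C3]; ring]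
  refine (abs_C2_one_sub_linear_le f α β ht ha hst).trans ?_
  have hm := m2_nonneg f
  have h4 := sinhBound_nonneg f α
  rw [mul_pow _ ((D : ℝ) ^ _), rpow_sub_one_sq hD, mul_assoc _ (A ^ 2)]
  gcongr

lemma expansion_linear_nontriangles_of_gt (hf : MemLp (fun x : ℝ => x) 4 f) (hg : MemLp (fun x : ℝ => x) 2 g)
    {α : ℝ} (hα : 0 < α) (μ : ℝ) :
    Expansion f g α 1 μ (fun a b => 0 < a ∧ 0 < b)
      (fun D a b β => C3 f D a b μ α β) (max (-1 / 2) (2 * μ - 2)) := by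
  refine expansion_of_le hf hg hα (le_max_of_le_left (by norm_num)) fun A hA => ⟨2 * α * m2 f +
    |m1 f| * (4 * α ^ 2 * m2 f * sinhBound f α + 4 * α ^ 2 * m1 f ^ 2 * sinhBound f α) * A ^ 2, ?_⟩
  intro D hD a b ha haA hb hbA _ hst β
  rw [sub_self, Real.rpow_zero, mul_one] at hst
  rw [add_sub_assoc]
  refine (abs_add_le _ _).trans ?_
  have hm := m2_nonneg f
  have h4 := sinhBound_nonneg f α
  rw [add_mul]
  exact add_le_add ((abs_C1_le f hα D β).trans
      (mul_le_mul_of_nonneg_left (rpow_le_max_left hD _ _) (by positivity)))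
    ((abs_C2_sub_C3_le α β hD ha hb hbA hst).trans
      (mul_le_mul_of_nonneg_left (rpow_le_max_right hD _ _) (by positivity)))

lemma expansion_linear_nontriangles_half (hf : MemLp (fun x : ℝ => x) 4 f) (hg : MemLp (fun x : ℝ => x) 2 g)
    {α : ℝ} (hα : 0 < α) :
    Expansion f g α 1 (1 / 2) (fun a b => 0 < a ∧ 0 < b)
      (fun D a b β => C1 f D α β + 4 * b * α ^ 2 * Real.sin (2 * β) ^ 2 * m1 f ^ 3 *
        Real.exp (-4 * a * α ^ 2 * m2 f) * (1 / Real.sqrt D)) (-1) := by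
  refine expansion_of_le hf hg hα le_rfl fun A hA => ⟨
    |m1 f| * (4 * α ^ 2 * m2 f * sinhBound f α + 4 * α ^ 2 * m1 f ^ 2 * sinhBound f α) * A ^ 2, ?_⟩
  intro D hD a b ha haA hb hbA _ hst β
  rw [sub_self, Real.rpow_zero, mul_one] at hst
  rw [add_sub_add_left_eq_sub, one_div_sqrt_eq]
  refine (abs_C2_sub_C3_le α β hD ha hb hbA hst).trans (le_of_eq ?_)
  norm_num

lemma expansion_linear_nontriangles_of_lt (hf : MemLp (fun x : ℝ => x) 4 f) (hg : MemLp (fun x : ℝ => x) 2 g)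
    {α : ℝ} (hα : 0 < α) {μ : ℝ} (hμ : 0 ≤ μ) :
    Expansion f g α 1 μ (fun a b => 0 < a ∧ 0 < b)
      (fun D _ _ β => C1 f D α β) (μ - 1) := by
  refine expansion_of_le hf hg hα (by linarith) fun A hA => ⟨|m1 f| * sinhBound f α * A, ?_⟩
  intro D hD a b ha haA hb hbA _ hst β
  rw [sub_self, Real.rpow_zero, mul_one] at hst
  rw [add_sub_cancel_left]
  refine (abs_C2_one_le f α β (by positivity) ha hst).trans ?_
  have h4 := sinhBound_nonneg f α
  rw [mul_assoc _ A]
  gcongr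

end Expansions

/-! ### Optimal angles -/

section Angles

open Set Filter

/-- The best `β` is where `w = 1`, whatever `γ` is, so the infimum over `β` is `-φ γ`. No lower
bound on `w` is needed. -/
lemma isOptimalAngle_of_unimodal {L : ℝ → ℝ → ℝ} {w φ : ℝ → ℝ} {γs : ℝ} (hγs : 0 < γs)
    (hL : ∀ γ, 0 < γ → ∀ β, L γ β = -(w β * φ γ)) (hw : ∀ β, w β ≤ 1) (hw1 : ∃ β, w β = 1)
    (hφ : ∀ γ, 0 < γ → 0 < φ γ) (hmono : StrictMonoOn φ (Ioc 0 γs))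
    (hanti : StrictAntiOn φ (Ici γs)) : IsOptimalAngle L γs := by
  obtain ⟨β₁, hβ₁⟩ := hw1
  have hlow : ∀ γ, 0 < γ → ∀ β, -φ γ ≤ L γ β := fun γ hγ β => by
    rw [hL γ hγ, neg_le_neg_iff]
    exact mul_le_of_le_one_left (hφ γ hγ).le (hw β)
  have hatt : ∀ γ, 0 < γ → L γ β₁ = -φ γ := fun γ hγ => by rw [hL γ hγ, hβ₁, one_mul]
  have hmax : ∀ γ, 0 < γ → γ ≠ γs → φ γ < φ γs := fun γ hγ hne => by
    rcases lt_or_gt_of_ne hne with h | h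
    · exact hmono ⟨hγ, h.le⟩ ⟨hγs, le_rfl⟩ h
    · exact hanti self_mem_Ici h.le h
  have hmax' : ∀ γ, 0 < γ → φ γ ≤ φ γs := fun γ hγ => by
    rcases eq_or_ne γ γs with rfl | h
    · exact le_rfl
    · exact (hmax γ hγ h).le
  have hinf : ∀ γ, 0 < γ → ⨅ β, L γ β = -φ γ := fun γ hγ => by
    refine le_antisymm ?_ (le_ciInf (hlow γ hγ))
    rw [← hatt γ hγ]
    exact ciInf_le ⟨-φ γ, by rintro _ ⟨β, rfl⟩; exact hlow γ hγ β⟩ β₁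
  refine ⟨fun γ' => ⟨?_, ?_⟩, hγs, ?_, ?_⟩
  · rintro ⟨hγ', β, hβ⟩
    by_contra hne
    have h1 := hβ γs hγs β₁
    rw [hatt γs hγs] at h1
    linarith [hlow γ' hγ' β, hmax γ' hγ' hne]
  · rintro rfl
    refine ⟨hγs, β₁, fun γ hγ β => ?_⟩
    rw [hatt _ hγs]
    linarith [hlow γ hγ β, hmax' γ hγ]
  · filter_upwards [Ioi_mem_nhds hγs] with γ hγ
    rw [hinf γs hγs, hinf γ hγ]
    exact neg_le_neg (hmax' γ hγ)
  · intro γ' hγ' hlt hext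
    -- `-φ` falls strictly on the left of `γs`: a point just to the right refutes a local minimum,
    -- one just to the left a local maximum.
    rcases hext with h | h
    · obtain ⟨x, h1, hx⟩ := ((Filter.Eventually.filter_mono nhdsWithin_le_nhds h).and
        (Ioo_mem_nhdsGT hlt)).exists
      have hx0 : 0 < x := hγ'.trans hx.1
      simp only [hinf γ' hγ', hinf x hx0] at h1
      linarith [hmono ⟨hγ', hlt.le⟩ ⟨hx0, hx.2.le⟩ hx.1]
    · obtain ⟨x, h1, hx⟩ := ((Filter.Eventually.filter_mono nhdsWithin_le_nhds h).and
        (Ioo_mem_nhdsLT hγ')).exists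
      simp only [hinf γ' hγ', hinf x hx.1] at h1
      linarith [hmono ⟨hx.1, (hx.2.trans hlt).le⟩ ⟨hγ', hlt.le⟩ hx.2]

lemma strictMonoOn_mul_exp_neg {c : ℝ} (hc : 0 < c) :
    StrictMonoOn (fun u : ℝ => u * Real.exp (-(c * u))) (Icc 0 (1 / c)) ∧
      StrictAntiOn (fun u : ℝ => u * Real.exp (-(c * u))) (Ici (1 / c)) := by
  have hd : ∀ u : ℝ, HasDerivAt (fun u : ℝ => u * Real.exp (-(c * u)))
      ((1 - c * u) * Real.exp (-(c * u))) u := fun u => by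
    have h1 : HasDerivAt (fun u : ℝ => -(c * u)) (-c) u := by
      simpa using ((hasDerivAt_id' u).const_mul c).fun_neg
    exact ((hasDerivAt_id' u).fun_mul h1.exp).congr_deriv (by ring)
  have hcont : Continuous fun u : ℝ => u * Real.exp (-(c * u)) := by fun_prop
  constructor
  · refine strictMonoOn_of_deriv_pos (convex_Icc _ _) hcont.continuousOn fun u hu => ?_
    rw [interior_Icc] at hu
    rw [(hd u).deriv]
    have : c * u < 1 := by rw [mul_comm]; exact (lt_div_iff₀ hc).1 hu.2
    have := Real.exp_pos (-(c * u))
    nlinarith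
  · refine strictAntiOn_of_deriv_neg (convex_Ici _) hcont.continuousOn fun u hu => ?_
    rw [interior_Ici] at hu
    rw [(hd u).deriv]
    have : 1 < c * u := by rw [mul_comm]; exact (div_lt_iff₀ hc).1 hu
    have := Real.exp_pos (-(c * u))
    nlinarith

/-- The derivative is a positive factor times `(a + b)/(a - b) - exp(2bu)`, which changes sign
exactly once; `b < a` makes the ratio positive. -/
lemma strictMonoOn_exp_neg_mul_sinh {a b : ℝ} (hb : 0 < b) (hba : b < a) :
    StrictMonoOn (fun u : ℝ => Real.exp (-(a * u)) * Real.sinh (b * u))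
        (Icc 0 (Real.log ((a + b) / (a - b)) / (2 * b))) ∧
      StrictAntiOn (fun u : ℝ => Real.exp (-(a * u)) * Real.sinh (b * u))
        (Ici (Real.log ((a + b) / (a - b)) / (2 * b))) := by
  have hd : ∀ u : ℝ, HasDerivAt (fun u : ℝ => Real.exp (-(a * u)) * Real.sinh (b * u))
      (Real.exp (-(a * u)) * Real.exp (-(b * u)) * (a - b) / 2 *
        ((a + b) / (a - b) - Real.exp (2 * b * u))) u := fun u => by
    have h1 : HasDerivAt (fun u : ℝ => -(a * u)) (-a) u := by
      simpa using ((hasDerivAt_id' u).const_mul a).fun_neg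
    have h2 : HasDerivAt (fun u : ℝ => b * u) b u := by
      simpa using (hasDerivAt_id' u).const_mul b
    refine (h1.exp.fun_mul h2.sinh).congr_deriv ?_
    have h3 : Real.exp (2 * b * u) = Real.exp (b * u) * Real.exp (b * u) := by
      rw [← Real.exp_add]; ring_nf
    have h4 : Real.exp (-(b * u)) * Real.exp (b * u) = 1 := by rw [← Real.exp_add]; simp
    have hab : a - b ≠ 0 := by linarith
    rw [Real.sinh_eq, Real.cosh_eq, h3]
    generalize Real.exp (b * u) = X at *
    generalize Real.exp (-(b * u)) = Y at *
    field_simp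
    linear_combination ((a - b) * X) * h4
  have hcont : Continuous fun u : ℝ => Real.exp (-(a * u)) * Real.sinh (b * u) := by fun_prop
  have hr : 0 < (a + b) / (a - b) := div_pos (by linarith) (by linarith)
  have hpos : ∀ u : ℝ, 0 < Real.exp (-(a * u)) * Real.exp (-(b * u)) * (a - b) / 2 := fun u => by
    have : 0 < a - b := by linarith
    positivity
  constructor
  · refine strictMonoOn_of_deriv_pos (convex_Icc _ _) hcont.continuousOn fun u hu => ?_
    rw [interior_Icc] at hu
    rw [(hd u).deriv]
    refine mul_pos (hpos u) (sub_pos.2 ?_)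
    rw [← Real.lt_log_iff_exp_lt hr, mul_comm]
    exact (lt_div_iff₀ (by positivity)).1 hu.2
  · refine strictAntiOn_of_deriv_neg (convex_Ici _) hcont.continuousOn fun u hu => ?_
    rw [interior_Ici] at hu
    rw [(hd u).deriv]
    refine mul_neg_of_pos_of_neg (hpos u) (sub_neg.2 ?_)
    rw [← Real.log_lt_iff_lt_exp hr, mul_comm]
    exact (div_lt_iff₀ (by positivity)).1 hu

lemma unimodal_comp_sq {Φ : ℝ → ℝ} {us : ℝ} (hmono : StrictMonoOn Φ (Icc 0 us))
    (hanti : StrictAntiOn Φ (Ici us)) :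
    StrictMonoOn (fun γ => Φ (γ ^ 2)) (Ioc 0 (Real.sqrt us)) ∧
      StrictAntiOn (fun γ => Φ (γ ^ 2)) (Ici (Real.sqrt us)) := by
  constructor
  · intro x hx y hy hxy
    have hus : ∀ z ∈ Ioc 0 (Real.sqrt us), z ^ 2 ∈ Icc 0 us := fun z hz =>
      ⟨sq_nonneg z, (Real.le_sqrt' hz.1).1 hz.2⟩
    exact hmono (hus x hx) (hus y hy) (pow_lt_pow_left₀ hxy hx.1.le (by norm_num))
  · intro x hx y hy hxy
    have hus : ∀ z ∈ Ici (Real.sqrt us), z ^ 2 ∈ Ici us := fun z hz => Real.sqrt_le_iff.1 hz |>.2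
    exact hanti (hus x hx) (hus y hy)
      (pow_lt_pow_left₀ hxy ((Real.sqrt_nonneg us).trans hx) (by norm_num))

/-- Both signs of `m` reduce to the same unimodal problem with amplitude `|m| κ`. For `m > 0` the
function is nonnegative and vanishes at `γ = 0`, so minimisation is trivial. -/
lemma isSignedOptimalAngle_of_unimodal {L : ℝ → ℝ → ℝ} {Φ : ℝ → ℝ} {m κ us : ℝ} (hus : 0 < us)
    (hκ : 0 < κ) (hL : ∀ γ β, L γ β = Real.sin (2 * β) ^ 2 * (m * κ) * Φ (γ ^ 2))
    (h0 : Φ 0 = 0) (hΦ : ∀ u, 0 < u → 0 < Φ u) (hmono : StrictMonoOn Φ (Icc 0 us))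
    (hanti : StrictAntiOn Φ (Ici us)) : IsSignedOptimalAngle m L (Real.sqrt us) := by
  obtain ⟨h1, h2⟩ := unimodal_comp_sq hmono hanti
  have hw : ∀ β : ℝ, Real.sin (2 * β) ^ 2 ≤ 1 := fun β => Real.sin_sq_le_one _
  have hw1 : ∃ β : ℝ, Real.sin (2 * β) ^ 2 = 1 := ⟨Real.pi / 4, by
    rw [show 2 * (Real.pi / 4) = Real.pi / 2 by ring, Real.sin_pi_div_two, one_pow]⟩
  have key : ∀ (L' : ℝ → ℝ → ℝ) (k : ℝ), 0 < k →
      (∀ γ β, L' γ β = -(Real.sin (2 * β) ^ 2 * (k * Φ (γ ^ 2)))) →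
      IsOptimalAngle L' (Real.sqrt us) := fun L' k hk hL' =>
    isOptimalAngle_of_unimodal (φ := fun γ => k * Φ (γ ^ 2)) (Real.sqrt_pos.2 hus)
      (fun γ _ β => hL' γ β) hw hw1 (fun γ hγ => mul_pos hk (hΦ _ (by positivity)))
      (fun x hx y hy hxy => mul_lt_mul_of_pos_left (h1 hx hy hxy) hk)
      (fun x hx y hy hxy => mul_lt_mul_of_pos_left (h2 hx hy hxy) hk)
  refine ⟨fun hm => ?_, fun hm => ⟨?_, fun γ β β' => ?_⟩⟩
  · exact key L (-m * κ) (mul_pos (neg_pos.2 hm) hκ) fun γ β => by rw [hL]; ring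
  · exact key _ (m * κ) (mul_pos hm hκ) fun γ β => by rw [hL]; ring
  · have : 0 ≤ Φ (γ ^ 2) := by
      rcases eq_or_ne γ 0 with rfl | h
      · simp [h0]
      · exact (hΦ _ (by positivity)).le
    rw [hL, hL, zero_pow two_ne_zero, h0, mul_zero]
    positivity

variable {f : Measure ℝ} {D : ℕ}

/-- This term is odd in `γ`, so it is not a function of `γ²`. Its `γ`-profile squared is `u
exp(-cu)` at `u = γ²`, and monotonicity passes to the square root because the profile is
nonnegative. -/
lemma isOptimalAngle_C1 (hD : 1 ≤ D) (hm : 0 < m2 f) :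
    IsOptimalAngle (fun γ β => C1 f D (Real.sqrt D * γ) β) (eta f D 4) := by
  have hD0 : (0 : ℝ) < D := by exact_mod_cast hD
  have hs : Real.sqrt D ^ 2 = D := Real.sq_sqrt hD0.le
  have hs0 : 0 < Real.sqrt D := Real.sqrt_pos.2 hD0
  have heta : eta f D 4 = Real.sqrt (1 / (4 * D * m2 f)) := by
    rw [eta, Real.sqrt_div zero_le_one, Real.sqrt_one]
  obtain ⟨h1, h2⟩ := strictMonoOn_mul_exp_neg (c := 4 * D * m2 f) (by positivity)
  obtain ⟨h3, h4⟩ := unimodal_comp_sq h1 h2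
  set φ : ℝ → ℝ := fun γ => γ * Real.exp (-(2 * D * m2 f * γ ^ 2)) with hφ
  have hφsq : ∀ γ, γ ^ 2 * Real.exp (-(4 * D * m2 f * γ ^ 2)) = φ γ ^ 2 := fun γ => by
    rw [hφ, mul_pow, ← Real.exp_nat_mul]
    congr 2; push_cast; ring
  have hφ0 : ∀ γ, 0 ≤ γ → 0 ≤ φ γ := fun γ hγ => mul_nonneg hγ (Real.exp_pos _).le
  simp only [hφsq] at h3 h4
  rw [heta]
  have hpos : 0 < Real.sqrt (1 / (4 * D * m2 f)) := Real.sqrt_pos.2 (by positivity)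
  refine isOptimalAngle_of_unimodal (w := fun β => -Real.sin (4 * β))
    (φ := fun γ => 2 * m2 f * φ γ) hpos ?_ (fun β => by linarith [Real.neg_one_le_sin (4 * β)])
    ⟨-(Real.pi / 8), ?_⟩ (fun γ hγ => ?_) (fun x hx y hy hxy => ?_) (fun x hx y hy hxy => ?_)
  · intro γ _ β
    simp only [C1, hφ]
    rw [show -2 * (Real.sqrt D * γ) ^ 2 * m2 f = -(2 * D * m2 f * γ ^ 2) by
      rw [mul_pow, hs]; ring]
    field_simp
  · rw [show 4 * -(Real.pi / 8) = -(Real.pi / 2) by ring, Real.sin_neg, Real.sin_pi_div_two,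
      neg_neg]
  · have : 0 < φ γ := mul_pos hγ (Real.exp_pos _)
    positivity
  · exact mul_lt_mul_of_pos_left (lt_of_pow_lt_pow_left₀ 2 (hφ0 y hy.1.le) (h3 hx hy hxy))
      (by positivity)
  · exact mul_lt_mul_of_pos_left
      (lt_of_pow_lt_pow_left₀ 2 (hφ0 x (hpos.le.trans hx)) (h4 hx hy hxy)) (by positivity)

lemma isSignedOptimalAngle_C2 (hD : 1 ≤ D) {θ₁ θ₂ : ℝ} (hθ₂ : 0 < θ₂)
    (hθ : m1 f ≠ 0 → θ₂ * m1 f ^ 2 < θ₁ * m2 f) :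
    IsSignedOptimalAngle (m1 f) (fun γ β => C2 f (Real.sqrt D * γ) β θ₁ θ₂)
      (zeta f D θ₁ θ₂) := by
  -- With zero mean both clauses of the claim are vacuous.
  rcases eq_or_ne (m1 f) 0 with h | hm
  · rw [h]; exact ⟨fun h => absurd h (lt_irrefl _), fun h => absurd h (lt_irrefl _)⟩
  have hD0 : (0 : ℝ) < D := by exact_mod_cast hD
  have hs : Real.sqrt D ^ 2 = D := Real.sq_sqrt hD0.le
  have hlt := hθ hm
  have hb : 0 < 4 * D * (θ₂ * m1 f ^ 2) := by positivity
  have hba : 4 * D * (θ₂ * m1 f ^ 2) < 4 * D * (θ₁ * m2 f) := by gcongr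
  obtain ⟨h1, h2⟩ := strictMonoOn_exp_neg_mul_sinh hb hba
  have hratio : (4 * D * (θ₁ * m2 f) + 4 * D * (θ₂ * m1 f ^ 2)) /
      (4 * D * (θ₁ * m2 f) - 4 * D * (θ₂ * m1 f ^ 2)) =
      (θ₁ * m2 f + θ₂ * m1 f ^ 2) / (θ₁ * m2 f - θ₂ * m1 f ^ 2) := by
    rw [← mul_add, ← mul_sub, mul_div_mul_left _ _ (by positivity)]
  have hpos : 0 < θ₂ * m1 f ^ 2 := by positivity
  have hzeta : zeta f D θ₁ θ₂ = Real.sqrt (Real.log ((4 * D * (θ₁ * m2 f) +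
      4 * D * (θ₂ * m1 f ^ 2)) / (4 * D * (θ₁ * m2 f) - 4 * D * (θ₂ * m1 f ^ 2))) /
        (2 * (4 * D * (θ₂ * m1 f ^ 2)))) := by
    rw [zeta, hratio]
    congr 1
    field_simp
    ring
  rw [hzeta]
  refine isSignedOptimalAngle_of_unimodal (κ := 1) ?_ one_pos (fun γ β => ?_) (by simp)
    (fun u hu => ?_) h1 h2
  · rw [hratio]
    refine div_pos (Real.log_pos ?_) (by positivity)
    rw [one_lt_div (by linarith)]
    linarith
  · simp only [C2]
    rw [mul_one, ← mul_assoc]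
    congr 2 <;> [congr 1; skip] <;> rw [mul_pow, hs] <;> ring
  · exact mul_pos (Real.exp_pos _) (Real.sinh_pos_iff.2 (by positivity))

lemma isSignedOptimalAngle_C3 (hD : 1 ≤ D) {a b : ℝ} (ha : 0 < a) (hb : 0 < b) (μ : ℝ)
    (hm2 : m1 f ≠ 0 → 0 < m2 f) :
    IsSignedOptimalAngle (m1 f) (fun γ β => C3 f D a b μ (Real.sqrt D * γ) β)
      (eta f D (4 * a)) := by
  rcases eq_or_ne (m1 f) 0 with h | hm
  · rw [h]; exact ⟨fun h => absurd h (lt_irrefl _), fun h => absurd h (lt_irrefl _)⟩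
  have hD0 : (0 : ℝ) < D := by exact_mod_cast hD
  have hs : Real.sqrt D ^ 2 = D := Real.sq_sqrt hD0.le
  have hm2 := hm2 hm
  have heta : eta f D (4 * a) = Real.sqrt (1 / (4 * a * D * m2 f)) := by
    rw [eta, Real.sqrt_div zero_le_one, Real.sqrt_one]
  obtain ⟨h1, h2⟩ := strictMonoOn_mul_exp_neg (c := 4 * a * D * m2 f) (by positivity)
  rw [heta]
  refine isSignedOptimalAngle_of_unimodal (κ := 4 * b * D * m1 f ^ 2 * (D : ℝ) ^ (μ - 1))
    (by positivity) (by positivity) (fun γ β => ?_) (by simp)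
    (fun u hu => mul_pos hu (Real.exp_pos _)) h1 h2
  simp only [C3]
  rw [show -4 * a * (Real.sqrt D * γ) ^ 2 * m2 f = -(4 * a * D * m2 f * γ ^ 2) by
    rw [mul_pow, hs]; ring, mul_pow, hs]
  ring

end Angles

end QAOA

end

/-! ### Assembly of the regimes -/

theorem mainTheorem4 (f g : MeasureTheory.Measure ℝ)
    [MeasureTheory.IsProbabilityMeasure f] [MeasureTheory.IsProbabilityMeasure g]
    (hf : MeasureTheory.MemLp (fun x : ℝ => x) 4 f)
    (hg : MeasureTheory.MemLp (fun x : ℝ => x) 2 g) :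
    -- expansions of the scaled expected cost
    (∀ α : ℝ, 0 < α → ∀ lam μ : ℝ, 0 ≤ lam → lam ≤ 1 → 0 ≤ μ → μ ≤ 1 →
      (lam = 1 →
        QAOA.Expansion f g α lam μ (fun a b => b = 0 ∧ a = 1)
          (fun D _ _ β => QAOA.C1 f D α β) (-1)) ∧
      (μ = 1 →
        QAOA.Expansion f g α lam μ (fun a b => a = 0 ∧ b = 1)
          (fun D _ _ β => QAOA.C1 f D α β + QAOA.C2 f α β 1 1) (-1)) ∧
      (lam = 1 → μ = 1 →
        QAOA.Expansion f g α lam μ (fun a b => 0 < a ∧ 0 < b)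
          (fun D _ b β => QAOA.C1 f D α β + QAOA.C2 f α β 1 b) (-1)) ∧
      (μ = 1 → lam < 1 / 2 →
        QAOA.Expansion f g α lam μ (fun a b => 0 < a ∧ 0 < b)
          (fun D _ b β => QAOA.C1 f D α β + QAOA.C2 f α β b b) (lam - 1)) ∧
      (μ = 1 → lam = 1 / 2 →
        QAOA.Expansion f g α lam μ (fun a b => 0 < a ∧ 0 < b)
          (fun D a b β => QAOA.C1 f D α β +
            QAOA.C2 f α β b b * (1 - 4 * a * α ^ 2 * QAOA.m2 f * (1 / Real.sqrt D)))
          (max (2 * lam - 2) (-1))) ∧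
      (μ = 1 → 1 / 2 < lam → lam < 1 →
        QAOA.Expansion f g α lam μ (fun a b => 0 < a ∧ 0 < b)
          (fun D a b β =>
            QAOA.C2 f α β b b * (1 - 4 * a * α ^ 2 * QAOA.m2 f * (D : ℝ) ^ (lam - 1)))
          (max (-1 / 2) (2 * lam - 2))) ∧
      (lam = 1 → 1 / 2 < μ → μ < 1 →
        QAOA.Expansion f g α lam μ (fun a b => 0 < a ∧ 0 < b)
          (fun D a b β => QAOA.C3 f D a b μ α β) (max (-1 / 2) (2 * μ - 2))) ∧
      (lam = 1 → μ = 1 / 2 →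
        QAOA.Expansion f g α lam μ (fun a b => 0 < a ∧ 0 < b)
          (fun D a b β => QAOA.C1 f D α β +
            4 * b * α ^ 2 * Real.sin (2 * β) ^ 2 * QAOA.m1 f ^ 3 *
              Real.exp (-4 * a * α ^ 2 * QAOA.m2 f) * (1 / Real.sqrt D)) (-1)) ∧
      (lam = 1 → μ < 1 / 2 →
        QAOA.Expansion f g α lam μ (fun a b => 0 < a ∧ 0 < b)
          (fun D _ _ β => QAOA.C1 f D α β) (μ - 1))) ∧
    -- optimal angles of the leading terms, as functions of `γ = α / √D` and `β`
    (∀ D : ℕ, 1 ≤ D →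
      -- leading term `C₁` (no triangles; or `lam = 1`, `μ < 1 / 2`)
      (0 < QAOA.m2 f →
        QAOA.IsOptimalAngle (fun γ β => QAOA.C1 f D (Real.sqrt D * γ) β) (QAOA.eta f D 4)) ∧
      -- `a = 0`, `b = μ = 1`
      (QAOA.m1 f ^ 2 < QAOA.m2 f →
        QAOA.IsSignedOptimalAngle (QAOA.m1 f)
          (fun γ β => QAOA.C2 f (Real.sqrt D * γ) β 1 1) (QAOA.zeta f D 1 1)) ∧
      -- `lam = μ = 1`, so `a + b = 1`
      (∀ a b : ℝ, 0 < a → 0 < b → a + b = 1 →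
        QAOA.IsSignedOptimalAngle (QAOA.m1 f)
          (fun γ β => QAOA.C2 f (Real.sqrt D * γ) β 1 b) (QAOA.zeta f D 1 b)) ∧
      -- `μ = 1`, `lam < 1`
      (∀ b : ℝ, 0 < b → QAOA.m1 f ^ 2 < QAOA.m2 f →
        QAOA.IsSignedOptimalAngle (QAOA.m1 f)
          (fun γ β => QAOA.C2 f (Real.sqrt D * γ) β b b) (QAOA.zeta f D b b)) ∧
      -- `lam = 1`, `1 / 2 < μ < 1`
      (∀ a b μ : ℝ, 0 < a → 0 < b → 1 / 2 < μ → μ < 1 →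
        QAOA.IsSignedOptimalAngle (QAOA.m1 f)
          (fun γ β => QAOA.C3 f D a b μ (Real.sqrt D * γ) β) (QAOA.eta f D (4 * a)))) := by
  have hf2 : MemLp (fun x : ℝ => x) 2 f := hf.mono_exponent (by norm_num)
  have hv := QAOA.m1_sq_le_m2 hf2
  have hsq : QAOA.m1 f ≠ 0 → 0 < QAOA.m1 f ^ 2 := fun h => by positivity
  refine ⟨fun α hα lam μ hlam _ hμ _ => ⟨?_, ?_, ?_, ?_, ?_, ?_, ?_, ?_, ?_⟩,
    fun D hD => ⟨?_, ?_, ?_, ?_, ?_⟩⟩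
  · rintro rfl
    exact QAOA.expansion_no_triangles hf hg hα μ
  · rintro rfl
    exact QAOA.expansion_all_triangles hf hg hα lam
  · rintro rfl rfl
    exact QAOA.expansion_linear_linear hf hg hα
  · rintro rfl _
    exact QAOA.expansion_linear_triangles_of_lt hf hg hα hlam
  · rintro rfl rfl
    exact QAOA.expansion_linear_triangles_half hf hg hα
  · rintro rfl _ _
    exact QAOA.expansion_linear_triangles_of_gt hf hg hα lam
  · rintro rfl _ _
    exact QAOA.expansion_linear_nontriangles_of_gt hf hg hα μ
  · rintro rfl rfl
    exact QAOA.expansion_linear_nontriangles_half hf hg hα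
  · rintro rfl _
    exact QAOA.expansion_linear_nontriangles_of_lt hf hg hα hμ
  · exact QAOA.isOptimalAngle_C1 hD
  · intro h
    exact QAOA.isSignedOptimalAngle_C2 hD one_pos fun _ => by linarith
  · intro a b ha hb hab
    -- Here `b < 1`, so `b 𝔼[J]² < 𝔼[J]² ≤ 𝔼[J²]`; no positive variance is required.
    exact QAOA.isSignedOptimalAngle_C2 hD hb fun h => by nlinarith [hsq h]
  · intro b hb h
    exact QAOA.isSignedOptimalAngle_C2 hD hb fun _ => mul_lt_mul_of_pos_left h hb
  · intro a b μ ha hb _ _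
    exact QAOA.isSignedOptimalAngle_C3 hD ha hb μ fun h => (hsq h).trans_le hv
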